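/- Let $\mathrm{Un}=\{\neg,\mathbf X,\mathbf F,\mathbf G\}$ be the unary LTL operators and let $\mathrm{Bin}=\{\lor,\wedge,\Rightarrow,\Leftarrow,\Leftrightarrow\}\cup\{\text{their negations}\}$ be the ten logical binary operators. For an LTL formula $\varphi$, its size $|\varphi|$ is its number of distinct sub-formulas, and $|\varphi|_{\mathrm{Bin}}$ is the number of its distinct sub-formulas whose outermost operator is binary. For all sets $\mathsf U\subseteq\mathrm{Un}$ and $\mathsf B\subseteq\mathrm{Bin}$ and every fixed $n\in\mathbb N$, the following decision problem is in $\mathsf L$ (deterministic logarithmic space). Input: a finite set $\mathsf{Prop}$ of propositions, two finite collections $\mathcal P,\mathcal N$ of ultimately periodic words $u\cdot v^\omega$ with $u\in(2^{\mathsf{Prop}})^*$ and $v\in(2^{\mathsf{Prop}})^+$ (each given by the pair $(u,v)$, letters written as bit vectors), and a bound $B\in\mathbb N$ written in unary. Question: is there an LTL formula $\varphi$ over $\mathsf{Prop}$, built from propositions with operators in $\mathsf U\cup\mathsf B$ only, such that $|\varphi|\le B$, $|\varphi|_{\mathrm{Bin}}\le n$, $w\models\varphi$ for all $w\in\mathcal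 P$, and $w\not\models\varphi$ for all $w\in\mathcal N$? -/

import Mathlib

/-! ### LTL: syntax and semantics -/

/-- Unary operators: negation, next, future, globally. -/
inductive UnOp
  | not | X | F | G
  deriving DecidableEq

/-- Binary temporal operators: until, release, weak until, mighty release. -/
inductive BinTempOp
  | U | R | W | M
  deriving DecidableEq

/-- Binary logical operators: the classical ones and their negations. -/
inductive BinLogOp
  | or | and | imp | revImp | iff
  | nor | nand | nimp | nrevImp | niff
  deriving DecidableEq

/-- The truth function of a binary logical operator. -/
def BinLogOp.eval : BinLogOp → Prop → Prop → Prop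
  | .or, a, b => a ∨ b
  | .and, a, b => a ∧ b
  | .imp, a, b => a → b
  | .revImp, a, b => b → a
  | .iff, a, b => a ↔ b
  | .nor, a, b => ¬ (a ∨ b)
  | .nand, a, b => ¬ (a ∧ b)
  | .nimp, a, b => ¬ (a → b)
  | .nrevImp, a, b => ¬ (b → a)
  | .niff, a, b => ¬ (a ↔ b)

/-- LTL formulas over a type `α` of propositions. -/
inductive LTL (α : Type)
  | atom (p : α)
  | un (o : UnOp) (φ : LTL α)
  | binTemp (o : BinTempOp) (φ ψ : LTL α)
  | binLog (o : BinLogOp) (φ ψ : LTL α)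
  deriving DecidableEq

namespace LTL

variable {α : Type}

/-- The formula uses only operators from the given sets. -/
def UsesOnly (Ut : Set UnOp) (Bt : Set BinTempOp) (Bl : Set BinLogOp) : LTL α → Prop
  | atom _ => True
  | un o φ => o ∈ Ut ∧ UsesOnly Ut Bt Bl φ
  | binTemp o φ ψ => o ∈ Bt ∧ UsesOnly Ut Bt Bl φ ∧ UsesOnly Ut Bt Bl ψ
  | binLog o φ ψ => o ∈ Bl ∧ UsesOnly Ut Bt Bl φ ∧ UsesOnly Ut Bt Bl ψ

/-- The set of sub-formulas. -/
def subF [DecidableEq α] : LTL α → Finset (LTL α)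
  | atom p => {atom p}
  | un o φ => insert (un o φ) (subF φ)
  | binTemp o φ ψ => insert (binTemp o φ ψ) (subF φ ∪ subF ψ)
  | binLog o φ ψ => insert (binLog o φ ψ) (subF φ ∪ subF ψ)

/-- Whether the outermost operator is binary. -/
def isBin : LTL α → Bool
  | atom _ => false
  | un _ _ => false
  | binTemp _ _ _ => true
  | binLog _ _ _ => true

/-- The size of a formula: its number of distinct sub-formulas. -/
def size [DecidableEq α] (φ : LTL α) : ℕ := φ.subF.card

/-- The number of distinct sub-formulas whose outermost operator is binary. -/
def numBin [DecidableEq α] (φ : LTL α) : ℕ := (φ.subF.filter fun ψ => ψ.isBin = true).card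

/-- The suffix of an infinite word from position `i` on (positions start at `0`). -/
def suffix (w : ℕ → Set α) (i : ℕ) : ℕ → Set α := fun j => w (i + j)

/-- `Sat w φ`: the infinite word `w` over the alphabet of sets of propositions satisfies `φ`. -/
def Sat (w : ℕ → Set α) : LTL α → Prop
  | atom p => p ∈ w 0
  | un .not φ => ¬ Sat w φ
  | un .X φ => Sat (suffix w 1) φ
  | un .F φ => ∃ i, Sat (suffix w i) φ
  | un .G φ => ∀ i, Sat (suffix w i) φ
  | binTemp .U φ ψ => ∃ i, Sat (suffix w i) ψ ∧ ∀ j < i, Sat (suffix w j) φ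
  | binTemp .R φ ψ => ¬ ∃ i, ¬ Sat (suffix w i) ψ ∧ ∀ j < i, ¬ Sat (suffix w j) φ
  | binTemp .W φ ψ =>
      (∃ i, Sat (suffix w i) ψ ∧ ∀ j < i, Sat (suffix w j) φ) ∨ ∀ i, Sat (suffix w i) φ
  | binTemp .M φ ψ =>
      (¬ ∃ i, ¬ Sat (suffix w i) ψ ∧ ∀ j < i, ¬ Sat (suffix w j) φ) ∧ ∃ i, Sat (suffix w i) φ
  | binLog o φ ψ => o.eval (Sat w φ) (Sat w ψ)

end LTL

/-! ### Ultimately periodic words and the learning problem -/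

/-- A presentation of the ultimately periodic word `pre · per^ω` with `per` non-empty; letters are
sets of propositions. -/
structure UPWord (α : Type) where
  pre : List (Finset α)
  per : List (Finset α)
  per_ne : per ≠ []

/-- The infinite word `pre · per^ω`. -/
def UPWord.toWord {α : Type} (w : UPWord α) (i : ℕ) : Set α :=
  if h : i < w.pre.length then (w.pre[i] : Set α)
  else (w.per[(i - w.pre.length) % w.per.length]'
    (Nat.mod_lt _ (List.length_pos_of_ne_nil w.per_ne)) : Set α)

/-- An input of the LTL learning problem: a number of propositions, the finite collections of
positive and negative ultimately periodic words (as explicit lists), and the size bound. -/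
structure LearnInput where
  numProp : ℕ
  pos : List (UPWord (Fin numProp))
  neg : List (UPWord (Fin numProp))
  bound : ℕ

/-- The input is a positive instance of the learning problem for the given sets of operators and
the given bound `n` on the number of occurrences of binary operators. -/
def LearnInput.IsPositive (Ut : Set UnOp) (Bt : Set BinTempOp) (Bl : Set BinLogOp) (n : ℕ∞)
    (I : LearnInput) : Prop :=
  ∃ φ : LTL (Fin I.numProp), φ.UsesOnly Ut Bt Bl ∧ φ.size ≤ I.bound ∧ (φ.numBin : ℕ∞) ≤ n ∧
    (∀ w ∈ I.pos, LTL.Sat w.toWord φ) ∧ (∀ w ∈ I.neg, ¬ LTL.Sat w.toWord φ)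

/-- The finite alphabet in which inputs are written. -/
inductive LearnSym
  | prop | tick | pos | neg | loop | letter | zero | one
  deriving DecidableEq

instance : Fintype LearnSym where
  elems := {.prop, .tick, .pos, .neg, .loop, .letter, .zero, .one}
  complete := by intro x; cases x <;> decide

/-- A letter is written as the symbol `letter` followed by its characteristic bit vector. -/
def encodeLetter {m : ℕ} (a : Finset (Fin m)) : List LearnSym :=
  LearnSym.letter :: List.ofFn fun i => if i ∈ a then LearnSym.one else LearnSym.zero

/-- A word is written as its polarity mark, the letters of the prefix, the symbol `loop`, and the
letters of the period. -/
def encodeWord {m : ℕ} (mark : LearnSym) (w : UPWord (Fin m)) : List LearnSym :=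
  mark :: (w.pre.flatMap encodeLetter ++ LearnSym.loop :: w.per.flatMap encodeLetter)

/-- The encoding of an input; the number of propositions and the size bound are in unary. -/
def LearnInput.encode (I : LearnInput) : List LearnSym :=
  List.replicate I.numProp LearnSym.prop ++ List.replicate I.bound LearnSym.tick ++
    I.pos.flatMap (encodeWord LearnSym.pos) ++ I.neg.flatMap (encodeWord LearnSym.neg)

/-- The LTL learning problem, as the language of the encodings of its positive instances. -/
def LTLLearn (Ut : Set UnOp) (Bt : Set BinTempOp) (Bl : Set BinLogOp) (n : ℕ∞) : Language LearnSym :=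
  {x | ∃ I : LearnInput, I.encode = x ∧ I.IsPositive Ut Bt Bl n}

/-! ### Deterministic logarithmic space -/

/-- Head movements. -/
inductive HeadMove
  | left | stay | right
  deriving DecidableEq

/-- What the input head can read: an input symbol or one of the two end markers. -/
inductive InSym (A : Type)
  | leftEnd
  | sym (a : A)
  | rightEnd

/-- A deterministic Turing machine with a two-way read-only input tape and finitely many one-way
infinite read-write work tapes. The transition function reads the state, the scanned input symbol
and the scanned work symbols; it either halts (`none`) or gives the new state, the move of the
input head, and the symbol to write and the move on each work tape. -/
structure OfflineTM (A : Type) where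
  State : Type
  Work : Type
  tapes : ℕ
  finState : Finite State
  finWork : Finite Work
  start : State
  accept : Set State
  blank : Work
  trans : State → InSym A → (Fin tapes → Work) →
    Option (State × HeadMove × (Fin tapes → Work × HeadMove))

namespace OfflineTM

variable {A : Type}

/-- A configuration: the state, the position of the input head, and the head position and the
contents of every work tape. -/
structure Cfg (M : OfflineTM A) where
  state : M.State
  inPos : ℕ
  head : Fin M.tapes → ℕ
  tape : Fin M.tapes → ℕ → M.Work

/-- The symbol at position `p` of the input tape holding `x`: the left end marker is at position
`0`, the input at positions `1, …, |x|`, the right end marker at position `|x| + 1`. -/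
def readInput (x : List A) : ℕ → InSym A
  | 0 => .leftEnd
  | p + 1 => match x[p]? with
    | some a => .sym a
    | none => .rightEnd

/-- Moving a head on a one-way infinite tape; at position `0` a left move has no effect. -/
def moveHead : HeadMove → ℕ → ℕ
  | .left, p => p - 1
  | .stay, p => p
  | .right, p => p + 1

/-- One step on input `x`; `none` if the machine halts. The input head cannot leave the part of
the tape between the two end markers. -/
def step (M : OfflineTM A) (x : List A) (c : M.Cfg) : Option M.Cfg :=
  (M.trans c.state (readInput x c.inPos) fun i => c.tape i (c.head i)).map fun r =>
    { state := r.1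
      inPos := min (moveHead r.2.1 c.inPos) (x.length + 1)
      head := fun i => moveHead (r.2.2 i).2 (c.head i)
      tape := fun i => Function.update (c.tape i) (c.head i) (r.2.2 i).1 }

/-- The initial configuration. -/
def init (M : OfflineTM A) : M.Cfg where
  state := M.start
  inPos := 0
  head := fun _ => 0
  tape := fun _ _ => M.blank

/-- On every input `x`, the machine halts, it accepts if and only if `x ∈ L`, and during the whole
run every work head stays within the first `s |x|` cells of its tape. -/
def DecidesInSpace (M : OfflineTM A) (L : Language A) (s : ℕ → ℕ) : Prop :=
  ∀ x : List A,
    (∃ c : M.Cfg, StateTransition.Reaches (M.step x) M.init c ∧ M.step x c = none ∧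
      (c.state ∈ M.accept ↔ x ∈ L)) ∧
    ∀ c : M.Cfg, StateTransition.Reaches (M.step x) M.init c → ∀ i, c.head i < s x.length

end OfflineTM

/-- The class of languages decidable in deterministic logarithmic space. -/
def InLogspace {A : Type} [Finite A] (L : Language A) : Prop :=
  ∃ (M : OfflineTM A) (c : ℕ), M.DecidesInSpace L fun n => c * (Nat.log 2 n + 1)

/-!
The truth of a formula at a position of a word depends on the truth of its operand at all positions,
and over the unary operators `¬`, `X`, `F`, `G` every chain of operators acts on such truth values
like a power of `X` followed by one of finitely many modalities. A formula with at most `n` distinct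
sub-formulas with a binary operator is therefore equivalent to the result of one of finitely many
circuits, instantiated with propositions and with exponents of `X`; the circuit can be chosen such
that its size does not exceed the size of the formula. Propositions and exponents are bounded by the
length of the input, so a machine can run through all of them with a constant number of binary
counters of logarithmic length. On an ultimately periodic word, `F` and `G` need to look only at the
next `|u| + |v|` positions, so a fixed circuit is evaluated at a position of a word by a constant
number of nested loops over positions.
-/

/-! ### Structured programs for offline Turing machines -/

/-- Work tape symbols: a mark for the leftmost cell, binary digits, and the blank. -/
inductive Cell
  | mark | zero | one | blank
  deriving DecidableEq

instance : Fintype Cell where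
  elems := {.mark, .zero, .one, .blank}
  complete := by intro c; cases c <;> decide

/-- What one step of a program does: it moves the input head, writes on and moves the head of every
work tape, and sets the flag. -/
structure Effect (k : ℕ) where
  inMove : HeadMove
  write : Fin k → Cell
  move : Fin k → HeadMove
  flag : Bool

/-- Structured programs over `k` work tapes and one Boolean flag. Actions and tests see the scanned
input symbol, the scanned work symbols, and the flag. -/
inductive Prog (A : Type) (k : ℕ)
  | skip
  | act (f : InSym A → (Fin k → Cell) → Bool → Effect k)
  | seq (p q : Prog A k)
  | ite (t : InSym A → (Fin k → Cell) → Bool → Bool) (p q : Prog A k)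
  | loop (t : InSym A → (Fin k → Cell) → Bool → Bool) (p : Prog A k)

/-- The data a program works on: the position of the input head, the flag, and the work tapes. -/
@[ext]
structure Store (k : ℕ) where
  inPos : ℕ
  flag : Bool
  head : Fin k → ℕ
  tape : Fin k → ℕ → Cell

namespace Prog

variable {A : Type} {k : ℕ}

/-- The effect that changes nothing when the scanned symbols are `w` and the flag is `b`. -/
def idle (w : Fin k → Cell) (b : Bool) : Effect k := ⟨.stay, w, fun _ => .stay, b⟩

/-- One step of a program: the program that remains to be run, and the effect of the step. -/
def next : Prog A k → InSym A → (Fin k → Cell) → Bool → Option (Prog A k × Effect k)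
  | skip, _, _, _ => none
  | act f, a, w, b => some (skip, f a w b)
  | seq p q, a, w, b =>
    match next p a w b with
    | none => some (q, idle w b)
    | some (p', e) => some (seq p' q, e)
  | ite t p q, a, w, b => some (if t a w b then p else q, idle w b)
  | loop t p, a, w, b => some (if t a w b then seq p (loop t p) else skip, idle w b)

/-- A finite set of programs that contains the given one and is closed under `next`; it is the set
of control states of the Turing machine that runs the program. -/
def residuals : Prog A k → Set (Prog A k)
  | skip => {skip}
  | act f => {act f, skip}
  | seq p q => (fun r => seq r q) '' residuals p ∪ residuals q
  | ite t p q => insert (ite t p q) (residuals p ∪ residuals q)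
  | loop t p => {loop t p, skip} ∪ (fun r => seq r (loop t p)) '' residuals p

theorem residuals_finite (p : Prog A k) : p.residuals.Finite := by
  induction p with
  | skip => exact Set.finite_singleton _
  | act f => exact (Set.finite_singleton _).insert _
  | seq p q hp hq => exact (hp.image _).union hq
  | ite t p q hp hq => exact (hp.union hq).insert _
  | loop t p hp => exact ((Set.finite_singleton _).insert _).union (hp.image _)

theorem self_mem_residuals (p : Prog A k) : p ∈ p.residuals := by
  induction p with
  | seq p _ hp _ => exact Or.inl ⟨p, hp, rfl⟩
  | _ => simp [residuals]

theorem next_seq_cases {p q r : Prog A k} {a w b e} (h : (seq p q).next a w b = some (r, e)) :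
    r = q ∨ ∃ p', r = seq p' q ∧ p.next a w b = some (p', e) := by
  simp only [next] at h
  split at h
  · cases h; exact .inl rfl
  · next hp => cases h; exact .inr ⟨_, rfl, hp⟩

theorem next_mem_residuals {p₀ p r : Prog A k} {a w b e} (hp : p ∈ p₀.residuals)
    (h : p.next a w b = some (r, e)) : r ∈ p₀.residuals := by
  induction p₀ generalizing p r with
  | skip => cases hp; simp [next] at h
  | act f => rcases hp with rfl | rfl <;> simp_all [next, residuals]
  | seq p₁ p₂ ih₁ ih₂ =>
    rcases hp with ⟨p', hp', rfl⟩ | hp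
    · rcases next_seq_cases h with rfl | ⟨p'', rfl, h'⟩
      · exact .inr (self_mem_residuals _)
      · exact .inl ⟨_, ih₁ hp' h', rfl⟩
    · exact .inr (ih₂ hp h)
  | ite t p₁ p₂ ih₁ ih₂ =>
    rcases hp with rfl | hp | hp
    · simp only [next, Option.some.injEq, Prod.mk.injEq] at h
      rw [← h.1]
      split
      · exact .inr (.inl (self_mem_residuals _))
      · exact .inr (.inr (self_mem_residuals _))
    · exact .inr (.inl (ih₁ hp h))
    · exact .inr (.inr (ih₂ hp h))
  | loop t p₁ ih =>
    rcases hp with (rfl | rfl) | ⟨p', hp', rfl⟩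
    · simp only [next, Option.some.injEq, Prod.mk.injEq] at h
      rw [← h.1]
      split
      · exact .inr ⟨_, self_mem_residuals _, rfl⟩
      · exact .inl (.inr rfl)
    · simp [next] at h
    · rcases next_seq_cases h with rfl | ⟨p'', rfl, h'⟩
      · exact .inl (.inl rfl)
      · exact .inr ⟨_, ih hp' h', rfl⟩

/-- The Turing machine that runs a program; it accepts if the flag is set at the end. -/
def toTM (p₀ : Prog A k) : OfflineTM A where
  State := p₀.residuals × Bool
  Work := Cell
  tapes := k
  finState := by
    have := p₀.residuals_finite.to_subtype
    infer_instance
  finWork := inferInstance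
  start := (⟨p₀, p₀.self_mem_residuals⟩, false)
  accept := {s | s.2 = true}
  blank := .blank
  trans := fun s a w =>
    match h : s.1.1.next a w s.2 with
    | none => none
    | some (r, e) => some ((⟨r, next_mem_residuals s.1.2 h⟩, e.flag), e.inMove,
        fun i => (e.write i, e.move i))

end Prog

namespace Store

variable {A : Type} {k : ℕ}

/-- The symbols scanned on the work tapes. -/
def scan (s : Store k) : Fin k → Cell := fun i => s.tape i (s.head i)

/-- The store after a step with effect `e` on input `x`. -/
def apply (x : List A) (s : Store k) (e : Effect k) : Store k where
  inPos := min (OfflineTM.moveHead e.inMove s.inPos) (x.length + 1)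
  flag := e.flag
  head := fun i => OfflineTM.moveHead (e.move i) (s.head i)
  tape := fun i => Function.update (s.tape i) (s.head i) (e.write i)

/-- The input head is on the tape holding `x`, and all work heads are within the first `H` cells. -/
def Within (x : List A) (H : ℕ) (s : Store k) : Prop :=
  s.inPos ≤ x.length + 1 ∧ ∀ i, s.head i < H

/-- All tapes are blank and all heads are at the left end. -/
def initial (k : ℕ) : Store k := ⟨0, false, fun _ => 0, fun _ _ => .blank⟩

theorem apply_idle {x : List A} {H : ℕ} {s : Store k} (hs : s.Within x H) :
    s.apply x (Prog.idle s.scan s.flag) = s := by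
  ext1
  · simp [apply, Prog.idle, OfflineTM.moveHead, hs.1]
  · rfl
  · rfl
  · funext i
    simp [apply, Prog.idle, scan]

end Store

namespace Prog

variable {A : Type} {k : ℕ} (x : List A) (H : ℕ)

/-- One step of a program on input `x` to a store that is within `H` cells. -/
def Step (c d : Prog A k × Store k) : Prop :=
  ∃ e, c.1.next (OfflineTM.readInput x c.2.inPos) c.2.scan c.2.flag = some (d.1, e) ∧
    d.2 = c.2.apply x e ∧ d.2.Within x H

/-- The program `p` started in the store `s` terminates in the store `s'`, and stays within `H`
cells meanwhile. -/
def Runs (p : Prog A k) (s s' : Store k) : Prop :=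
  Relation.ReflTransGen (Step x H) (p, s) (skip, s')

variable {x H} {s s' s'' : Store k} {p p' q : Prog A k}

theorem runs_act {f : InSym A → (Fin k → Cell) → Bool → Effect k}
    (h : s.apply x (f (OfflineTM.readInput x s.inPos) s.scan s.flag) = s') (hs' : s'.Within x H) :
    Runs x H (act f) s s' :=
  .single ⟨_, rfl, h.symm, hs'⟩

theorem Runs.head (hs : s.Within x H)
    (hp : p.next (OfflineTM.readInput x s.inPos) s.scan s.flag = some (q, idle s.scan s.flag))
    (hq : Runs x H q s s') : Runs x H p s s' :=
  Relation.ReflTransGen.head ⟨_, hp, (Store.apply_idle hs).symm, hs⟩ hq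

theorem Step.seq {c d : Prog A k × Store k} (h : Step x H c d) (q : Prog A k) :
    Step x H (c.1.seq q, c.2) (d.1.seq q, d.2) := by
  obtain ⟨e, hnext, hd⟩ := h
  exact ⟨e, by simp [next, hnext], hd⟩

theorem Runs.seq (hp : Runs x H p s s') (hs' : s'.Within x H) (hq : Runs x H q s' s'') :
    Runs x H (seq p q) s s'' :=
  (Relation.ReflTransGen.lift (fun c : Prog A k × Store k => (c.1.seq q, c.2))
    (fun _ _ h => h.seq q) _ _ hp).trans (Runs.head hs' rfl hq)

/-- The configuration of the machine of `p₀` with residual program `p` and store `s`. -/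
def cfg (p₀ p : Prog A k) (hp : p ∈ p₀.residuals) (s : Store k) : p₀.toTM.Cfg where
  state := (⟨p, hp⟩, s.flag)
  inPos := s.inPos
  head := s.head
  tape := s.tape

variable {p₀ : Prog A k}

theorem step_cfg_skip (hp : skip ∈ p₀.residuals) (s : Store k) :
    p₀.toTM.step x (cfg p₀ skip hp s) = none := rfl

theorem step_cfg (hp : p ∈ p₀.residuals) {e : Effect k}
    (h : p.next (OfflineTM.readInput x s.inPos) s.scan s.flag = some (p', e)) :
    p₀.toTM.step x (cfg p₀ p hp s) = some (cfg p₀ p' (next_mem_residuals hp h) (s.apply x e)) := by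
  have htrans : p₀.toTM.trans (⟨p, hp⟩, s.flag) (OfflineTM.readInput x s.inPos) s.scan =
      some ((⟨p', next_mem_residuals hp h⟩, e.flag), e.inMove,
        fun i => (e.write i, e.move i)) := by
    simp only [toTM]
    split
    · next h' => exact absurd (h.symm.trans h') (by simp)
    · next h' => cases h.symm.trans h'; rfl
  exact congrArg (Option.map _) htrans

theorem Runs.reaches (h : Runs x H p s s') (hp : p ∈ p₀.residuals) : ∃ hp' : skip ∈ p₀.residuals,
    StateTransition.Reaches (p₀.toTM.step x) (cfg p₀ p hp s) (cfg p₀ skip hp' s') := by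
  unfold Runs at h
  generalize hc : (p, s) = c at h
  induction h using Relation.ReflTransGen.head_induction_on generalizing p s with
  | refl => cases hc; exact ⟨hp, .refl⟩
  | @head _ d hstep _ ih =>
    subst hc
    obtain ⟨e, hnext, hd, -⟩ := hstep
    obtain ⟨hp', hreach⟩ := ih (next_mem_residuals hp hnext) rfl
    refine ⟨hp', .head ?_ hreach⟩
    rw [step_cfg hp hnext, hd]
    rfl

theorem Runs.head_lt_of_reaches (h : Runs x H p s s') (hs : s.Within x H) (hp : p ∈ p₀.residuals)
    {c : p₀.toTM.Cfg} (hc : StateTransition.Reaches (p₀.toTM.step x) (cfg p₀ p hp s) c)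
    (i : Fin k) : c.head i < H := by
  unfold Runs at h
  generalize hd : (p, s) = d at h
  induction h using Relation.ReflTransGen.head_induction_on generalizing p s with
  | refl =>
    cases hd
    rcases Relation.ReflTransGen.cases_head hc with rfl | ⟨c', hc', -⟩
    · exact hs.2 i
    · simp [step_cfg_skip] at hc'
  | @head _ d hstep _ ih =>
    subst hd
    obtain ⟨e, hnext, hd, hw⟩ := hstep
    rcases Relation.ReflTransGen.cases_head hc with rfl | ⟨c', hc', hreach⟩
    · exact hs.2 i
    · rw [step_cfg hp hnext] at hc'
      obtain rfl := Option.some.inj hc'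
      exact ih hw (next_mem_residuals hp hnext) (hd ▸ hreach) rfl

theorem decidesInSpace {p : Prog A k} {L : Language A} {f g : ℕ → ℕ} (hf : ∀ n, 0 < f n)
    (hfg : ∀ n, f n ≤ g n)
    (h : ∀ x : List A, ∃ s, Runs x (f x.length) p (.initial k) s ∧ (s.flag = true ↔ x ∈ L)) :
    p.toTM.DecidesInSpace L g := by
  intro x
  obtain ⟨s, hs, hL⟩ := h x
  obtain ⟨hskip, hreach⟩ := hs.reaches p.self_mem_residuals
  exact ⟨⟨_, hreach, step_cfg_skip hskip s, hL⟩, fun c hc i =>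
    (hs.head_lt_of_reaches ⟨Nat.zero_le _, fun _ => hf _⟩ p.self_mem_residuals hc i).trans_le
      (hfg _)⟩

end Prog

/-! ### Total correctness within a space bound -/

namespace Prog

variable {A : Type} {k : ℕ}

/-- Total correctness within `H` cells: on input `x`, from every store within `H` cells that
satisfies `P`, the program `p` terminates in a store that satisfies `Q` and never leaves the first
`H` cells. -/
def Triple (x : List A) (H : ℕ) (p : Prog A k) (P Q : Store k → Prop) : Prop :=
  ∀ s, s.Within x H → P s → ∃ s', s'.Within x H ∧ Q s' ∧ Runs x H p s s'

variable {x : List A} {H : ℕ} {p q : Prog A k} {P P' Q Q' : Store k → Prop}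
  {t : InSym A → (Fin k → Cell) → Bool → Bool}

namespace Triple

theorem mono (h : Triple x H p P Q) (hP : ∀ s, P' s → P s) (hQ : ∀ s, Q s → Q' s) :
    Triple x H p P' Q' := fun s hs hs' =>
  let ⟨s', hw, hq, hr⟩ := h s hs (hP s hs')
  ⟨s', hw, hQ s' hq, hr⟩

theorem skip (h : ∀ s, P s → Q s) : Triple x H skip P Q := fun s hs hP =>
  ⟨s, hs, h s hP, .refl⟩

theorem act {f : InSym A → (Fin k → Cell) → Bool → Effect k}
    (h : ∀ s, s.Within x H → P s →
      Q (s.apply x (f (OfflineTM.readInput x s.inPos) s.scan s.flag)) ∧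
        (s.apply x (f (OfflineTM.readInput x s.inPos) s.scan s.flag)).Within x H) :
    Triple x H (act f) P Q := fun s hs hP =>
  ⟨_, (h s hs hP).2, (h s hs hP).1, runs_act rfl (h s hs hP).2⟩

theorem seq (hp : Triple x H p P Q) (hq : Triple x H q Q Q') : Triple x H (seq p q) P Q' :=
  fun s hs hP =>
    let ⟨_, hw, hQ, hr⟩ := hp s hs hP
    let ⟨s', hw', hQ', hr'⟩ := hq _ hw hQ
    ⟨s', hw', hQ', hr.seq hw hr'⟩

theorem ite (hp : Triple x H p
      (fun s => P s ∧ t (OfflineTM.readInput x s.inPos) s.scan s.flag = true) Q)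
    (hq : Triple x H q
      (fun s => P s ∧ t (OfflineTM.readInput x s.inPos) s.scan s.flag = false) Q) :
    Triple x H (ite t p q) P Q := fun s hs hP => by
  cases ht : t (OfflineTM.readInput x s.inPos) s.scan s.flag
  · obtain ⟨s', hw, hQ, hr⟩ := hq s hs ⟨hP, ht⟩
    exact ⟨s', hw, hQ, hr.head hs (by simp [next, ht])⟩
  · obtain ⟨s', hw, hQ, hr⟩ := hp s hs ⟨hP, ht⟩
    exact ⟨s', hw, hQ, hr.head hs (by simp [next, ht])⟩

theorem loop (I : ℕ → Store k → Prop) (m : ℕ)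
    (htest : ∀ j ≤ m, ∀ s, I j s →
      t (OfflineTM.readInput x s.inPos) s.scan s.flag = decide (j < m))
    (hbody : ∀ j < m, Triple x H p (I j) (I (j + 1))) : Triple x H (loop t p) (I 0) (I m) := by
  induction m generalizing I with
  | zero => exact fun s hs hI => ⟨s, hs, hI, .head hs (by simp [next, htest 0 le_rfl s hI]) .refl⟩
  | succ m ih =>
    intro s hs hI
    obtain ⟨s₁, hs₁, hI₁, hr₁⟩ := hbody 0 m.succ_pos s hs hI
    obtain ⟨s₂, hs₂, hI₂, hr₂⟩ := ih (fun j => I (j + 1))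
      (fun j hj s hs => by simpa using htest (j + 1) (by omega) s hs)
      (fun j hj => hbody _ (by omega)) s₁ hs₁ hI₁
    exact ⟨s₂, hs₂, hI₂, .head hs (by simp [next, htest 0 (by omega) s hI]) (hr₁.seq hs₁ hr₂)⟩

end Triple

/-- Repeats `body` until the program `check` sets the flag. -/
def loopUntil (check body : Prog A k) : Prog A k :=
  check.seq (loop (fun _ _ b => !b) (body.seq check))

theorem Triple.loopUntil {check body : Prog A k} (I : ℕ → Store k → Prop) (m : ℕ)
    (hcheck : ∀ j ≤ m, Triple x H check (I j) fun s => I j s ∧ (s.flag = true ↔ j = m))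
    (hbody : ∀ j < m, Triple x H body (I j) (I (j + 1))) :
    Triple x H (loopUntil check body) (I 0) fun s => I m s ∧ s.flag = true := by
  have hloop := Triple.loop (t := fun _ _ b => !b) (fun j s => I j s ∧ (s.flag = true ↔ j = m)) m
    (fun j hj s hs => ?_) fun j hj => ((hbody j hj).mono (fun s hs => hs.1) fun _ hs => hs).seq
      (hcheck (j + 1) hj)
  · exact (hcheck 0 (Nat.zero_le m)).seq
      (hloop.mono (fun _ hs => hs) fun s hs => ⟨hs.1, hs.2.mpr rfl⟩)
  · rw [Bool.eq_iff_iff, Bool.not_eq_true', ← Bool.not_eq_true, hs.2, decide_eq_true_iff]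
    omega

end Prog

/-! ### Binary counters on the work tapes -/

/-- The tape holding the number `v`: a mark, then the binary digits of `v`, the least significant
one first and without leading zeros, then blanks. -/
def digits (v : ℕ) : ℕ → Cell
  | 0 => .mark
  | j + 1 => if v.size ≤ j then .blank else if v.testBit j then .one else .zero

theorem digits_succ_eq_blank {v j : ℕ} : digits v (j + 1) = .blank ↔ v.size ≤ j := by
  simp only [digits]
  split_ifs <;> simp_all

theorem digits_succ_ne_mark (v j : ℕ) : digits v (j + 1) ≠ .mark := by
  simp only [digits]
  split_ifs <;> decide

theorem digits_injective : Function.Injective digits := by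
  intro v w h
  have hsize : v.size = w.size := eq_of_forall_ge_iff fun j => by
    rw [← digits_succ_eq_blank, ← digits_succ_eq_blank, h]
  refine Nat.eq_of_testBit_eq fun j => ?_
  have hj := congrFun h (j + 1)
  simp only [digits, ← hsize] at hj
  by_cases hlt : v.size ≤ j
  · rw [Nat.testBit_eq_false_of_lt (Nat.size_le.mp hlt),
      Nat.testBit_eq_false_of_lt (Nat.size_le.mp (hsize ▸ hlt))]
  · rw [if_neg hlt, if_neg hlt] at hj
    cases hv : v.testBit j <;> cases hw : w.testBit j <;> simp_all

theorem digits_zero_succ (j : ℕ) : digits 0 (j + 1) = .blank := by simp [digits]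

theorem digits_bit_succ_succ (b : Bool) (u j : ℕ) :
    digits (Nat.bit b u) (j + 2) = digits u (j + 1) := by
  by_cases h : Nat.bit b u = 0
  · rw [h, (Nat.bit_eq_zero_iff.mp h).1, digits_zero_succ, digits_zero_succ]
  · simp only [digits, Nat.size_bit h, Nat.testBit_bit_succ, Nat.succ_le_succ_iff]

theorem digits_bit_one {b : Bool} {u : ℕ} (h : Nat.bit b u ≠ 0) :
    digits (Nat.bit b u) 1 = bif b then .one else .zero := by
  have hsize : ¬ (Nat.bit b u).size ≤ 0 := by rw [Nat.size_bit h]; omega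
  rw [digits, if_neg hsize, Nat.testBit_bit_zero]
  cases b <;> rfl

theorem exists_carry (v : ℕ) : ∃ m < (v + 1).size, (∀ j < m, digits v (j + 1) = .one) ∧
    digits v (m + 1) ≠ .one ∧ ∀ j, digits (v + 1) (j + 1) =
      if j < m then .zero else if j = m then .one else digits v (j + 1) := by
  induction v using Nat.binaryRec with
  | zero => exact ⟨0, by decide, by simp, by decide, fun j => by
      rcases j with _ | j
      · decide
      · simpa [digits_zero_succ] using digits_bit_succ_succ true 0 j⟩
  | bit b u ih =>
    cases b
    · have hsucc : Nat.bit false u + 1 = Nat.bit true u := by simp [Nat.bit_val]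
      have hne : Nat.bit true u ≠ 0 := by simp
      refine ⟨0, by rw [hsucc, Nat.size_bit hne]; omega, by simp, ?_, fun j => ?_⟩
      · by_cases h : Nat.bit false u = 0
        · rw [h]; decide
        · rw [digits_bit_one h]; decide
      · rcases j with _ | j
        · rw [hsucc, digits_bit_one hne]; rfl
        · rw [hsucc, digits_bit_succ_succ, digits_bit_succ_succ]; rfl
    · obtain ⟨m, hm, hone, hnext, hdigits⟩ := ih
      have hsucc : Nat.bit true u + 1 = Nat.bit false (u + 1) := by simp [Nat.bit_val]; ring
      have hne : Nat.bit false (u + 1) ≠ 0 := by simp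
      refine ⟨m + 1, by rw [hsucc, Nat.size_bit hne]; omega, fun j hj => ?_, ?_, fun j => ?_⟩
      · rcases j with _ | j
        · rw [digits_bit_one (by simp)]; rfl
        · rw [digits_bit_succ_succ]
          exact hone j (by omega)
      · rwa [digits_bit_succ_succ]
      · rcases j with _ | j
        · rw [hsucc, digits_bit_one hne]; rfl
        · rw [hsucc, digits_bit_succ_succ, digits_bit_succ_succ, hdigits]
          simp only [Nat.add_lt_add_iff_right, Nat.add_right_cancel_iff]

namespace Store

variable {k : ℕ}

/-- The store with the input head at position `p`, flag `b`, all work heads at the left end, and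
the numbers `reg` on the work tapes. -/
def ofReg (p : ℕ) (b : Bool) (reg : Fin k → ℕ) : Store k :=
  ⟨p, b, fun _ => 0, fun i => digits (reg i)⟩

/-- The store with the work heads of the tapes in `R` at cell `j`, all other work heads at the left
end, and the tapes `T`. -/
def sweeping (p : ℕ) (b : Bool) (R : Finset (Fin k)) (j : ℕ) (T : Fin k → ℕ → Cell) : Store k :=
  ⟨p, b, fun i => if i ∈ R then j else 0, T⟩

theorem sweeping_zero {p : ℕ} {b : Bool} {R : Finset (Fin k)} {T : Fin k → ℕ → Cell} :
    sweeping p b R 0 T = ⟨p, b, fun _ => 0, T⟩ := by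
  simp [sweeping]

end Store

namespace Prog

variable {A : Type} {k : ℕ} {x : List A} {H p : ℕ} {b : Bool}

/-- Rewrites the cells scanned on the tapes in `R` and moves the heads of these tapes. -/
def stepOn (R : Finset (Fin k)) (m : HeadMove) (wr : Cell → Cell) : Prog A k :=
  act fun _ w b => ⟨.stay, fun i => if i ∈ R then wr (w i) else w i,
    fun i => if i ∈ R then m else .stay, b⟩

variable {R : Finset (Fin k)} {wr : Cell → Cell} {halt : (Fin k → Cell) → Bool}
  {T T' : Fin k → ℕ → Cell}

theorem triple_stepOn {m : HeadMove} {j j' : ℕ} (hm : OfflineTM.moveHead m j = j') (hj : j' < H)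
    (hT : ∀ i, T' i = if i ∈ R then Function.update (T i) j (wr (T i j)) else T i) :
    Triple x H (stepOn R m wr) (· = .sweeping p b R j T) (· = .sweeping p b R j' T') := by
  refine .act ?_
  rintro s ⟨hp, -⟩ rfl
  suffices h : Store.apply x (.sweeping p b R j T) _ = .sweeping p b R j' T' from
    ⟨h, h ▸ ⟨hp, fun i => by simp only [Store.sweeping]; split <;> omega⟩⟩
  ext1
  · simpa [Store.apply, Store.sweeping, OfflineTM.moveHead] using hp
  · rfl
  · funext i
    by_cases hi : i ∈ R <;> simp [Store.apply, Store.sweeping, OfflineTM.moveHead, hi, ← hm]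
  · funext i
    by_cases hi : i ∈ R <;> simp [Store.apply, Store.sweeping, Store.scan, hi, hT]

/-- Repeats `stepOn` until the test `halt` holds of the scanned work symbols. -/
def sweep (R : Finset (Fin k)) (m : HeadMove) (wr : Cell → Cell) (halt : (Fin k → Cell) → Bool) :
    Prog A k :=
  loop (fun _ w _ => !halt w) (stepOn R m wr)

/-- The tapes after the cells `a, …, b - 1` of the tapes in `R` have been rewritten. -/
def rewrite (R : Finset (Fin k)) (wr : Cell → Cell) (a b : ℕ) (T : Fin k → ℕ → Cell) :
    Fin k → ℕ → Cell :=
  fun i c => if i ∈ R ∧ a ≤ c ∧ c < b then wr (T i c) else T i c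

theorem rewrite_self (a : ℕ) : rewrite R wr a a T = T := by
  funext i c
  rw [rewrite, if_neg (by omega)]

theorem rewrite_id (a c : ℕ) : rewrite R id a c T = T := by
  funext i c
  simp only [rewrite, id_eq, ite_self]

theorem triple_sweep_right {n : ℕ} (hn : n + 1 < H)
    (hhalt : ∀ j ≤ n, halt (Store.scan (.sweeping p b R (j + 1) T)) = decide (j = n)) :
    Triple x H (sweep R .right wr halt) (· = .sweeping p b R 1 T)
      (· = .sweeping p b R (n + 1) (rewrite R wr 1 (n + 1) T)) := by
  have hloop := Triple.loop (x := x) (H := H) (p := stepOn R .right wr)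
    (t := fun _ w _ => !halt w)
    (fun j s => s = .sweeping p b R (j + 1) (rewrite R wr 1 (j + 1) T)) n ?_ ?_
  · simpa only [Nat.zero_add, rewrite_self, sweep] using hloop
  · rintro j hj s rfl
    have hscan : Store.scan (.sweeping p b R (j + 1) (rewrite R wr 1 (j + 1) T)) =
        Store.scan (.sweeping p b R (j + 1) T) := by
      funext i
      simp only [Store.scan, Store.sweeping, rewrite]
      split <;> simp
    rw [hscan, hhalt j hj, Bool.eq_iff_iff]
    simp
    omega
  · intro j hj
    refine triple_stepOn rfl (by omega) fun i => ?_
    by_cases hi : i ∈ R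
    · funext c
      by_cases hc : c = j + 1
      · simp [rewrite, hi, hc]
      · have : c < j + 1 + 1 ↔ c < j + 1 := by omega
        simp [rewrite, hi, hc, this]
    · funext c
      simp [rewrite, hi]

theorem triple_sweep_left {n : ℕ} (hn : n < H)
    (hhalt : ∀ j ≤ n, halt (Store.scan (.sweeping p b R j T)) = decide (j = 0)) :
    Triple x H (sweep R .left wr halt) (· = .sweeping p b R n T)
      (· = .sweeping p b R 0 (rewrite R wr 1 (n + 1) T)) := by
  have hloop := Triple.loop (x := x) (H := H) (p := stepOn R .left wr)
    (t := fun _ w _ => !halt w)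
    (fun j s => s = .sweeping p b R (n - j) (rewrite R wr (n - j + 1) (n + 1) T)) n ?_ ?_
  · simpa only [Nat.sub_zero, Nat.sub_self, rewrite_self, Nat.zero_add, sweep] using hloop
  · rintro j hj s rfl
    have hscan : Store.scan (.sweeping p b R (n - j) (rewrite R wr (n - j + 1) (n + 1) T)) =
        Store.scan (.sweeping p b R (n - j) T) := by
      funext i
      simp only [Store.scan, Store.sweeping, rewrite]
      split <;> simp
    rw [hscan, hhalt _ (by omega), Bool.eq_iff_iff]
    simp
    omega
  · intro j hj
    refine triple_stepOn (by simp only [OfflineTM.moveHead]; omega) (by omega) fun i => ?_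
    by_cases hi : i ∈ R
    · funext c
      by_cases hc : c = n - j
      · simp [rewrite, hi, hc]
        omega
      · have : n - (j + 1) + 1 ≤ c ↔ n - j + 1 ≤ c := by omega
        simp [rewrite, hi, hc, this]
    · funext c
      simp [rewrite, hi]

end Prog

namespace Prog

variable {A : Type} {k : ℕ} {x : List A} {H p : ℕ} {b : Bool}

/-- Moves the heads of the tapes in `R` back to the left end, rewriting the cells on the way; the
mark of the tape `r` tells where to stop. -/
def sweepBack (R : Finset (Fin k)) (r : Fin k) (wr : Cell → Cell) : Prog A k :=
  sweep R .left wr fun w => w r = .mark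

theorem triple_sweepBack {R : Finset (Fin k)} {r : Fin k} (hr : r ∈ R) {wr : Cell → Cell}
    {T : Fin k → ℕ → Cell} {n : ℕ} (hn : n < H) (hmark : T r 0 = .mark)
    (hne : ∀ c, T r (c + 1) ≠ .mark) :
    Triple x H (sweepBack R r wr) (· = .sweeping p b R n T)
      (· = ⟨p, b, fun _ => 0, rewrite R wr 1 (n + 1) T⟩) := by
  rw [← Store.sweeping_zero (R := R)]
  refine triple_sweep_left hn fun j _ => ?_
  rcases j with _ | j <;> simp [Store.scan, Store.sweeping, hr, hmark, hne]

/-- Increments the number on the tape `r`. -/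
def inc (r : Fin k) : Prog A k :=
  seq (stepOn {r} .right id) <| seq (sweep {r} .right (fun _ => .zero) fun w => w r ≠ .one) <|
    seq (stepOn {r} .stay fun _ => .one) (sweepBack {r} r id)

theorem triple_inc {r : Fin k} {reg : Fin k → ℕ} (hH : (reg r + 1).size < H) :
    Triple x H (inc r) (· = .ofReg p b reg)
      (· = .ofReg p b (Function.update reg r (reg r + 1))) := by
  obtain ⟨m, hm, hone, hnext, hdigits⟩ := exists_carry (reg r)
  set T : Fin k → ℕ → Cell := fun i => digits (reg i) with hT
  set T' : Fin k → ℕ → Cell := fun i => digits (Function.update reg r (reg r + 1) i) with hT'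
  rw [Store.ofReg, Store.ofReg, ← hT, ← hT', ← Store.sweeping_zero (R := {r})]
  refine (triple_stepOn rfl (T' := T) (by simp only [OfflineTM.moveHead]; omega) (by simp)).seq <|
    (triple_sweep_right (n := m) (by omega) fun j hj => ?_).seq <|
    (triple_stepOn rfl (T' := T') (by simp only [OfflineTM.moveHead]; omega) fun i => ?_).seq <|
    (triple_sweepBack (by simp) (by simp only [OfflineTM.moveHead]; omega) rfl ?_).mono
      (fun _ hs => hs) fun s hs => ?_
  · rcases hj.lt_or_eq with hj | rfl
    · simp [Store.scan, Store.sweeping, hT, hone j hj, hj.ne]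
    · simp [Store.scan, Store.sweeping, hT, hnext]
  · by_cases hi : i = r
    · subst hi
      funext c
      rcases c with _ | c
      · simp [T, T', rewrite, digits]
      · by_cases hc : c = m
        · simp [T', hdigits, hc]
        · simp [T, T', rewrite, hdigits, hc]
    · funext c
      simp [T, T', rewrite, hi]
  · simp [T', digits_succ_ne_mark]
  · rwa [rewrite_id] at hs

/-- Sets the number on the tape `r` to zero. -/
def clr (r : Fin k) : Prog A k :=
  seq (stepOn {r} .right id) <| seq (sweep {r} .right id fun w => w r = .blank)
    (sweepBack {r} r fun _ => .blank)

theorem triple_clr {r : Fin k} {reg : Fin k → ℕ} (hH : (reg r).size + 1 < H) :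
    Triple x H (clr r) (· = .ofReg p b reg) (· = .ofReg p b (Function.update reg r 0)) := by
  set T : Fin k → ℕ → Cell := fun i => digits (reg i) with hT
  rw [Store.ofReg, ← hT, ← Store.sweeping_zero (R := {r})]
  refine (triple_stepOn rfl (T' := T) (by simp only [OfflineTM.moveHead]; omega) (by simp)).seq <|
    (triple_sweep_right (n := (reg r).size) hH fun j hj => ?_).seq <|
    (triple_sweepBack (by simp) hH (by simp [rewrite_id, T, digits])
      (by simp [rewrite_id, T, digits_succ_ne_mark])).mono (fun _ hs => hs) fun s hs => ?_
  · rw [Bool.eq_iff_iff]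
    simp [Store.scan, Store.sweeping, hT, digits_succ_eq_blank]
    omega
  · rw [hs, rewrite_id, Store.ofReg]
    congr 1
    funext i c
    by_cases hi : i = r
    · subst hi
      rcases c with _ | c
      · simp [rewrite, T, digits]
      · by_cases hc : c ≤ (reg i).size
        · simp [rewrite, hc, digits_zero_succ]
        · simp [rewrite, hc, T, digits_zero_succ, digits_succ_eq_blank]
          omega
    · simp [rewrite, hi, T]

/-- Sets the flag to the value of a test. -/
def setFlag (t : InSym A → (Fin k → Cell) → Bool → Bool) : Prog A k :=
  act fun a w b => ⟨.stay, w, fun _ => .stay, t a w b⟩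

theorem triple_setFlag {t : InSym A → (Fin k → Cell) → Bool → Bool} {s : Store k} :
    Triple x H (setFlag t) (· = s)
      (· = { s with flag := t (OfflineTM.readInput x s.inPos) s.scan s.flag }) := by
  refine .act ?_
  rintro s hs rfl
  suffices h : s.apply x _ = { s with flag := t _ s.scan s.flag } from ⟨h, h ▸ hs⟩
  ext1
  · simp [Store.apply, OfflineTM.moveHead, hs.1]
  · rfl
  · rfl
  · funext i
    simp [Store.apply, Store.scan]

theorem exists_first_difference (v w : ℕ) : ∃ n ≤ v.size, (∀ j < n,
      digits v (j + 1) = digits w (j + 1) ∧ digits v (j + 1) ≠ .blank) ∧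
    (digits v (n + 1) ≠ digits w (n + 1) ∨ digits v (n + 1) = .blank) ∧
    (digits v (n + 1) = digits w (n + 1) ↔ v = w) := by
  classical
  have hex : ∃ n, digits v (n + 1) ≠ digits w (n + 1) ∨ digits v (n + 1) = .blank :=
    ⟨v.size, .inr (digits_succ_eq_blank.mpr le_rfl)⟩
  have hlt : ∀ j < Nat.find hex, digits v (j + 1) = digits w (j + 1) ∧
      digits v (j + 1) ≠ .blank := fun j hj => by simpa using Nat.find_min hex hj
  refine ⟨Nat.find hex, Nat.find_min' hex (.inr (digits_succ_eq_blank.mpr le_rfl)), hlt,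
    Nat.find_spec hex, fun heq => digits_injective (funext fun c => ?_), by rintro rfl; rfl⟩
  have hv : v.size ≤ Nat.find hex :=
    digits_succ_eq_blank.mp ((Nat.find_spec hex).resolve_left (not_not.mpr heq))
  have hw : w.size ≤ Nat.find hex := by
    rwa [← digits_succ_eq_blank, ← heq, digits_succ_eq_blank]
  rcases c with _ | c
  · rfl
  · rcases lt_or_ge c (Nat.find hex) with hc | hc
    · exact (hlt c hc).1
    · rw [digits_succ_eq_blank.mpr (hv.trans hc), digits_succ_eq_blank.mpr (hw.trans hc)]

/-- Sets the flag if the numbers on the tapes `r` and `s` are equal, and clears it otherwise. -/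
def eqt (r s : Fin k) : Prog A k :=
  seq (stepOn {r, s} .right id) <|
    seq (sweep {r, s} .right id fun w => w r ≠ w s ∨ w r = .blank) <|
    seq (setFlag fun _ w _ => w r = w s) (sweepBack {r, s} r id)

theorem triple_eqt {r s : Fin k} {reg : Fin k → ℕ} (hH : (reg r).size + 1 < H) :
    Triple x H (eqt r s) (· = .ofReg p b reg) (· = .ofReg p (decide (reg r = reg s)) reg) := by
  obtain ⟨n, hn, hlt, hhalt, heq⟩ := exists_first_difference (reg r) (reg s)
  set T : Fin k → ℕ → Cell := fun i => digits (reg i) with hT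
  rw [Store.ofReg, Store.ofReg, ← hT, ← Store.sweeping_zero (R := {r, s})]
  refine (triple_stepOn rfl (T' := T) (by simp only [OfflineTM.moveHead]; omega) (by simp)).seq <|
    (triple_sweep_right (n := n) (by omega) fun j hj => ?_).seq <|
    triple_setFlag.seq <|
    (triple_sweepBack (p := p) (b := decide (reg r = reg s)) (T := T) (n := n + 1) (by simp)
      (by omega) rfl fun c => digits_succ_ne_mark _ c).mono (fun s hs => ?_) fun s hs => ?_
  · rcases hj.lt_or_eq with hj | rfl
    · simp [Store.scan, Store.sweeping, hT, ← (hlt j hj).1, (hlt j hj).2, hj.ne]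
    · simpa [Store.scan, Store.sweeping, hT] using hhalt
  · rw [hs, rewrite_id]
    simp [Store.scan, Store.sweeping, hT, heq]
  · rw [hs, rewrite_id]

/-- Moves the input head. -/
def moveIn (m : HeadMove) : Prog A k := act fun _ w b => ⟨m, w, fun _ => .stay, b⟩

theorem triple_moveIn {m : HeadMove} {p' : ℕ} {reg : Fin k → ℕ}
    (hm : min (OfflineTM.moveHead m p) (x.length + 1) = p') :
    Triple x H (moveIn m) (· = .ofReg p b reg) (· = .ofReg p' b reg) := by
  refine .act ?_
  rintro s ⟨-, hhead⟩ rfl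
  suffices h : Store.apply x (.ofReg p b reg) _ = .ofReg p' b reg from
    ⟨h, h ▸ ⟨hm ▸ Nat.min_le_right _ _, hhead⟩⟩
  ext1
  · simp [Store.apply, Store.ofReg, hm]
  · rfl
  · rfl
  · funext i
    simp [Store.apply, Store.ofReg, Store.scan]

/-- Moves the input head to the left end marker. -/
def rewindIn : Prog A k :=
  loop (fun a _ _ => match a with | .leftEnd => false | _ => true) (moveIn .left)

theorem triple_rewindIn {reg : Fin k → ℕ} (hp : p ≤ x.length + 1) :
    Triple x H rewindIn (· = .ofReg p b reg) (· = .ofReg 0 b reg) := by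
  have hloop := Triple.loop (x := x) (H := H) (p := moveIn .left)
    (t := fun a _ _ => match a with | .leftEnd => false | _ => true)
    (fun j s => s = .ofReg (p - j) b reg) p ?_ ?_
  · simpa only [Nat.sub_zero, Nat.sub_self, rewindIn] using hloop
  · rintro j hj s rfl
    rcases hj.lt_or_eq with hj | rfl
    · obtain ⟨q, hq⟩ : ∃ q, p - j = q + 1 := ⟨p - j - 1, by omega⟩
      simp only [Store.ofReg, hq, OfflineTM.readInput]
      cases x[q]? <;> simp [hj]
    · simp [Store.ofReg, OfflineTM.readInput]
  · exact fun j hj => triple_moveIn (by simp only [OfflineTM.moveHead]; omega)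

theorem triple_mark_tapes (hH : 0 < H) :
    Triple x H (stepOn (Finset.univ : Finset (Fin k)) .stay fun _ => .mark) (· = .initial k)
      (· = .ofReg 0 false fun _ => 0) := by
  have hinit : Store.initial k = .sweeping 0 false Finset.univ 0 fun _ _ => .blank := by
    rw [Store.sweeping_zero]; rfl
  rw [Store.ofReg, hinit, ← Store.sweeping_zero (R := Finset.univ)]
  refine triple_stepOn rfl hH fun i => funext fun c => ?_
  rcases c with _ | c <;> simp [digits]

end Prog

/-- The work heads are at the left end, the work tapes hold numbers up to `K`, the first `d` of
which are given by `ρ`, and the input head is at a position in `pos`. -/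
def Store.Holds {k : ℕ} (K : ℕ) (pos : Set ℕ) (d : ℕ) (ρ : ℕ → ℕ) (s : Store k) : Prop :=
  ∃ p ∈ pos, ∃ b reg, s = .ofReg p b reg ∧ (∀ i, reg i ≤ K) ∧ ∀ i : Fin k, i < d → reg i = ρ i

theorem Store.Holds.mono {k K d d' : ℕ} {pos pos' : Set ℕ} {ρ ρ' : ℕ → ℕ} {s : Store k}
    (h : s.Holds K pos d ρ) (hd : d' ≤ d) (hpos : pos ⊆ pos' := by exact subset_rfl)
    (hρ : ∀ i < d', ρ i = ρ' i := by intros; rfl) : s.Holds K pos' d' ρ' := by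
  obtain ⟨p, hp, b, reg, rfl, hK, hreg⟩ := h
  exact ⟨p, hpos hp, b, reg, rfl, hK, fun i hi => (hreg i (by omega)).trans (hρ i hi)⟩

namespace Prog

open Store Function

variable {A : Type} {k K d d' : ℕ} {x : List A} {pos : Set ℕ} {ρ ρ' : ℕ → ℕ}

namespace Triple

theorem of_ofReg {H : ℕ} {q : Prog A k} {Q : Store k → Prop}
    (h : ∀ p b reg, p ∈ pos → p ≤ x.length + 1 → (∀ i, reg i ≤ K) →
      (∀ i : Fin k, i < d → reg i = ρ i) → Triple x H q (· = .ofReg p b reg) Q) :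
    Triple x H q (Holds K pos d ρ) Q := by
  rintro s hs ⟨p, hp, b, reg, rfl, hK, hreg⟩
  exact h p b reg hp hs.1 hK hreg _ hs rfl

theorem clr (hd : d < k) : Triple x (K.size + 3) (clr ⟨d, hd⟩) (Holds K pos d ρ)
    (Holds K pos (d + 1) (update ρ d 0)) :=
  .of_ofReg fun p b reg hp _ hK hreg =>
    (triple_clr (by have := Nat.size_le_size (hK ⟨d, hd⟩); omega)).mono (fun _ hs => hs) <| by
      rintro _ rfl
      refine ⟨p, hp, b, _, rfl, fun i => ?_, fun i hi => ?_⟩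
      · rw [update_apply]
        split
        exacts [Nat.zero_le _, hK i]
      · rcases Nat.lt_succ_iff_lt_or_eq.mp hi with hi | hi
        · rw [update_of_ne (by rintro rfl; simp at hi), update_of_ne hi.ne, hreg i hi]
        · obtain rfl : i = ⟨d, hd⟩ := Fin.ext hi
          rw [update_self, update_self]

theorem inc {r : ℕ} (hr : r < d) (hrk : r < k) (hK : ρ r < K) :
    Triple x (K.size + 3) (inc ⟨r, hrk⟩) (Holds K pos d ρ)
      (Holds K pos d (update ρ r (ρ r + 1))) :=
  .of_ofReg fun p b reg hp _ hreg hρ => by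
    have hr' : reg ⟨r, hrk⟩ = ρ r := hρ _ hr
    refine (triple_inc (by
      rw [hr']
      have : (ρ r + 1).size ≤ K.size := Nat.size_le_size hK
      omega)).mono (fun _ hs => hs) ?_
    rintro _ rfl
    refine ⟨p, hp, b, _, rfl, fun i => ?_, fun i hi => ?_⟩
    · rw [update_apply, hr']
      split
      exacts [hK, hreg i]
    · by_cases hi' : (i : ℕ) = r
      · obtain rfl : i = ⟨r, hrk⟩ := Fin.ext hi'
        rw [update_self, update_self, hr']
      · rw [update_of_ne (fun h => hi' (congrArg Fin.val h)), update_of_ne hi', hρ i hi]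

theorem eqt {r r' : ℕ} (hr : r < d) (hr' : r' < d) (hrk : r < k) (hrk' : r' < k) :
    Triple x (K.size + 3) (eqt ⟨r, hrk⟩ ⟨r', hrk'⟩) (Holds K pos d ρ)
      fun s => s.Holds K pos d ρ ∧ (s.flag = true ↔ ρ r = ρ r') :=
  .of_ofReg fun p b reg hp _ hreg hρ =>
    (triple_eqt (by have := Nat.size_le_size (hreg ⟨r, hrk⟩); omega)).mono (fun _ hs => hs) <| by
      rintro _ rfl
      refine ⟨⟨p, hp, _, reg, rfl, hreg, hρ⟩, ?_⟩
      rw [← hρ ⟨r, hrk⟩ hr, ← hρ ⟨r', hrk'⟩ hr']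
      exact decide_eq_true_iff

theorem setFlag {H p : ℕ} {t : InSym A → Bool} :
    Triple x H (setFlag fun a _ _ => t a) (Holds (k := k) K {p} d ρ)
      fun s => s.Holds K {p} d ρ ∧ s.flag = t (OfflineTM.readInput x p) :=
  .of_ofReg fun p' b reg hp' _ hreg hρ => triple_setFlag.mono (fun _ hs => hs) <| by
    rintro _ rfl
    obtain rfl := hp'
    exact ⟨⟨_, rfl, _, reg, rfl, hreg, hρ⟩, rfl⟩

theorem moveIn {H p p' : ℕ} {m : HeadMove}
    (hp : min (OfflineTM.moveHead m p) (x.length + 1) = p') :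
    Triple x H (moveIn m) (Holds (k := k) K {p} d ρ) (Holds K {p'} d ρ) :=
  .of_ofReg fun q b reg hq _ hreg hρ => by
    obtain rfl := hq
    refine (triple_moveIn hp).mono (fun _ hs => hs) ?_
    rintro _ rfl
    exact ⟨_, rfl, b, reg, rfl, hreg, hρ⟩

theorem rewindIn {H : ℕ} :
    Triple x H rewindIn (Holds (k := k) K pos d ρ) (Holds K {0} d ρ) :=
  .of_ofReg fun p b reg _ hp hreg hρ => (triple_rewindIn hp).mono (fun _ hs => hs) <| by
    rintro _ rfl
    exact ⟨_, rfl, b, reg, rfl, hreg, hρ⟩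

end Triple

/-- Adds the number on the tape `s` to the one on the tape `r`, counting on the tape `c`. -/
def addTo (r s c : Fin k) : Prog A k :=
  seq (clr c) (loopUntil (eqt c s) (seq (inc r) (inc c)))

theorem Triple.addTo {r s : ℕ} (hr : r < d) (hs : s < d) (hrs : r ≠ s) (hd : d < k)
    (hK : ρ r + ρ s ≤ K) :
    Triple x (K.size + 3) (addTo ⟨r, hr.trans hd⟩ ⟨s, hs.trans hd⟩ ⟨d, hd⟩) (Holds K pos d ρ)
      (Holds K pos d (update ρ r (ρ r + ρ s))) := by
  let σ : ℕ → ℕ → ℕ := fun j => update (update ρ r (ρ r + j)) d j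
  have hσr : ∀ j, σ j r = ρ r + j := fun j => by simp [σ, hr.ne]
  have hσs : ∀ j, σ j s = ρ s := fun j => by simp [σ, hs.ne, hrs.symm]
  have hσd : ∀ j, σ j d = j := fun j => by simp [σ]
  refine (Triple.clr hd).seq <| (Triple.loopUntil (fun j => Holds K pos (d + 1) (σ j)) (ρ s)
    (fun j _ => (Triple.eqt (by omega) (by omega) _ _).mono (fun _ hs => hs) ?_)
    fun j hj => ((Triple.inc (by omega) _ (by rw [hσr]; omega)).seq
      (Triple.inc (by omega) _ ?_)).mono (fun _ hs => hs) ?_).mono ?_ ?_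
  · rintro t ⟨ht, hflag⟩
    exact ⟨ht, by rw [hflag, hσd, hσs]⟩
  · rw [update_of_ne hr.ne', hσd]
    omega
  · refine fun t ht => ht.mono le_rfl subset_rfl fun i _ => ?_
    by_cases hid : i = d
    · simp [σ, hid, hr.ne']
    · by_cases hir : i = r
      · simp [σ, hir, hr.ne, Nat.add_assoc]
      · simp [σ, hid, hir]
  · exact fun t ht => ht.mono le_rfl subset_rfl fun i _ => by simp [σ]
  · exact fun t ht => ht.1.mono (by omega) subset_rfl fun i hi => by simp [σ, hi.ne]

/-- Adds the product of the numbers on the tapes `s` and `t` to the number on the tape `r`, counting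
on the tapes `c` and `c'`. -/
def mulTo (r s t c c' : Fin k) : Prog A k :=
  seq (clr c) (loopUntil (eqt c t) (seq (addTo r s c') (inc c)))

theorem Triple.mulTo {r s t : ℕ} (hr : r < d) (hs : s < d) (ht : t < d) (hrs : r ≠ s) (hrt : r ≠ t)
    (hd : d + 1 < k) (hK : ρ r + ρ s * ρ t ≤ K) (hKt : ρ t ≤ K) :
    Triple x (K.size + 3)
      (mulTo ⟨r, by omega⟩ ⟨s, by omega⟩ ⟨t, by omega⟩ ⟨d, by omega⟩ ⟨d + 1, hd⟩)
      (Holds K pos d ρ) (Holds K pos d (update ρ r (ρ r + ρ s * ρ t))) := by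
  let σ : ℕ → ℕ → ℕ := fun j => update (update ρ r (ρ r + ρ s * j)) d j
  have hσr : ∀ j, σ j r = ρ r + ρ s * j := fun j => by simp [σ, hr.ne]
  have hσs : ∀ j, σ j s = ρ s := fun j => by simp [σ, hs.ne, hrs.symm]
  have hσt : ∀ j, σ j t = ρ t := fun j => by simp [σ, ht.ne, hrt.symm]
  have hσd : ∀ j, σ j d = j := fun j => by simp [σ]
  refine (Triple.clr (by omega)).seq <| (Triple.loopUntil (fun j => Holds K pos (d + 1) (σ j)) (ρ t)
    (fun j _ => (Triple.eqt (by omega) (by omega) _ _).mono (fun _ hs => hs) ?_)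
    fun j hj => ((Triple.addTo (by omega) (by omega) hrs hd ?_).seq
      (Triple.inc (by omega) _ ?_)).mono (fun _ hs => hs) ?_).mono ?_ ?_
  · rintro u ⟨hu, hflag⟩
    exact ⟨hu, by rw [hflag, hσd, hσt]⟩
  · rw [hσr, hσs, Nat.add_assoc, ← Nat.mul_succ]
    exact (Nat.add_le_add_left (Nat.mul_le_mul_left _ hj) _).trans hK
  · rw [update_of_ne hr.ne', hσd]
    omega
  · refine fun u hu => hu.mono le_rfl subset_rfl fun i _ => ?_
    rw [hσr, hσs]
    by_cases hid : i = d
    · simp [σ, hid, hr.ne']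
    · by_cases hir : i = r
      · simp [σ, hir, hr.ne, Nat.add_assoc, Nat.mul_succ]
      · simp [σ, hid, hir]
  · exact fun u hu => hu.mono le_rfl subset_rfl fun i _ => by simp [σ]
  · exact fun u hu => hu.1.mono (by omega) subset_rfl fun i hi => by simp [σ, hi.ne]

/-- Writes the length of the input on the tape `r`. -/
def length (r : Fin k) : Prog A k :=
  seq (clr r) <| seq rewindIn <| seq (moveIn .right) <|
    loopUntil (setFlag fun a _ _ => match a with | .rightEnd => true | _ => false)
      (seq (inc r) (moveIn .right))

theorem Triple.length (hd : d < k) (hK : x.length ≤ K) :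
    Triple x (K.size + 3) (length ⟨d, hd⟩) (Holds K pos d ρ)
      (Holds K Set.univ (d + 1) (update ρ d x.length)) := by
  refine (Triple.clr hd).seq <| Triple.rewindIn.seq <| (Triple.moveIn (p' := 1) (by
    simp [OfflineTM.moveHead])).seq <| (Triple.loopUntil
      (fun j => Holds K {j + 1} (d + 1) (update ρ d j)) x.length
      (fun j hj => Triple.setFlag.mono (fun _ hs => hs) fun s hs => ⟨hs.1, hs.2 ▸ ?_⟩)
      fun j hj => .seq ?_ (Triple.moveIn (p := j + 1) (by
        simp only [OfflineTM.moveHead]; omega))).mono (fun _ hs => hs)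
      fun s hs => hs.1.mono le_rfl (Set.subset_univ _)
  · simpa using Triple.inc (pos := {j + 1}) (ρ := update ρ d j) (Nat.lt_succ_self d) hd
      (by rw [update_self]; omega)
  · rcases hj.lt_or_eq with hj | rfl
    · simp [OfflineTM.readInput, hj, hj.ne]
    · simp [OfflineTM.readInput]

/-- Moves the input head to the input symbol whose index is on the tape `r`, counting on the tape
`c`; the head stops at the right end marker if there is no such symbol. -/
def seek (r c : Fin k) : Prog A k :=
  seq rewindIn <| seq (moveIn .right) <| seq (clr c) <|
    loopUntil (eqt c r) (seq (inc c) (moveIn .right))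

theorem Triple.seek {r : ℕ} (hr : r < d) (hd : d < k) (hK : ρ r ≤ K) :
    Triple x (K.size + 3) (seek ⟨r, hr.trans hd⟩ ⟨d, hd⟩) (Holds K pos d ρ)
      (Holds K {min (ρ r + 1) (x.length + 1)} d ρ) := by
  refine Triple.rewindIn.seq <| (Triple.moveIn (p' := 1) (by simp [OfflineTM.moveHead])).seq <|
    (Triple.clr hd).seq <| (Triple.loopUntil
      (fun j => Holds K {min (j + 1) (x.length + 1)} (d + 1) (update ρ d j)) (ρ r)
      (fun j _ => (Triple.eqt (by omega) (by omega) _ _).mono (fun _ hs => hs) fun s hs => ?_)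
      fun j hj => .seq ?_ (Triple.moveIn (p := min (j + 1) (x.length + 1))
        (by simp only [OfflineTM.moveHead]; omega))).mono ?_ ?_
  · exact ⟨hs.1, by simpa [hr.ne] using hs.2⟩
  · simpa using Triple.inc (pos := {min (j + 1) (x.length + 1)}) (ρ := update ρ d j)
      (Nat.lt_succ_self d) hd (by rw [update_self]; omega)
  · exact fun s hs => hs.mono le_rfl (by simp)
  · exact fun s hs => hs.1.mono (Nat.le_succ d) subset_rfl fun i hi => update_of_ne hi.ne _ _

end Prog

/-! ### Functions and predicates computable in logarithmic space -/

section LogFun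

/-- Contexts: an input together with the values of finitely many variables. -/
class Ctx (A : outParam Type) (Γ : Type) where
  depth : ℕ
  inp : Γ → List A
  env : Γ → ℕ → ℕ

namespace Ctx

variable {A Γ : Type}

instance : Ctx A (List A) where
  depth := 0
  inp := id
  env := fun _ _ => 0

instance [Ctx A Γ] : Ctx A (Γ × ℕ) where
  depth := depth Γ + 1
  inp := fun p => inp p.1
  env := fun p => Function.update (env p.1) (depth Γ) p.2

variable [Ctx A Γ] {g : Γ} {D D' K e v : ℕ} {ρ : ℕ → ℕ}

/-- The registers `ρ` begin with the variables of the context `g`, and `K` is at least the `D`-th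
power of some number exceeding these variables and the length of the input. -/
def Fits (g : Γ) (D K : ℕ) (ρ : ℕ → ℕ) : Prop :=
  ∃ M, (inp g).length + 2 ≤ M ∧ (∀ i < depth Γ, ρ i = env g i ∧ ρ i ≤ M) ∧ M ^ D ≤ K

namespace Fits

theorem mono (h : Fits g D' K ρ) (hD : D ≤ D') : Fits g D K ρ := by
  obtain ⟨M, hM, hρ, hK⟩ := h
  exact ⟨M, hM, hρ, (Nat.pow_le_pow_right (by omega) hD).trans hK⟩

theorem update (h : Fits g D K ρ) (he : depth Γ ≤ e) (v : ℕ) :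
    Fits g D K (Function.update ρ e v) := by
  obtain ⟨M, hM, hρ, hK⟩ := h
  refine ⟨M, hM, fun i hi => ?_, hK⟩
  rw [Function.update_of_ne (by omega)]
  exact hρ i hi

theorem exists_mul_le (h : Fits g (D + D') K ρ) :
    ∃ K₁ K₂, Fits g D K₁ ρ ∧ Fits g D' K₂ ρ ∧ K₁ * K₂ ≤ K := by
  obtain ⟨M, hM, hρ, hK⟩ := h
  exact ⟨M ^ D, M ^ D', ⟨M, hM, hρ, le_rfl⟩, ⟨M, hM, hρ, le_rfl⟩, pow_add M D D' ▸ hK⟩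

theorem exists_two_mul_le (h : Fits g (D + 1) K ρ) :
    ∃ K', 0 < K' ∧ Fits g D K' ρ ∧ 2 * K' ≤ K := by
  obtain ⟨M, hM, hρ, hK⟩ := h
  have hpos : 0 < M ^ D := Nat.pow_pos (by omega)
  exact ⟨M ^ D, hpos, ⟨M, hM, hρ, le_rfl⟩, by rw [pow_succ] at hK; nlinarith⟩

theorem length_add_two_le (h : Fits g D K ρ) (hD : 1 ≤ D) : (inp g).length + 2 ≤ K := by
  obtain ⟨M, hM, -, hK⟩ := h.mono hD
  rw [pow_one] at hK
  omega

theorem le (h : Fits g D K ρ) (hD : 1 ≤ D) {i : ℕ} (hi : i < depth Γ) : ρ i ≤ K := by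
  obtain ⟨M, -, hρ, hK⟩ := h.mono hD
  exact (hρ i hi).2.trans (pow_one M ▸ hK)

theorem fst {g : Γ × ℕ} (h : Fits g D K ρ) : Fits g.1 D K ρ := by
  obtain ⟨M, hM, hρ, hK⟩ := h
  refine ⟨M, hM, fun i hi => ?_, hK⟩
  obtain ⟨heq, hle⟩ := hρ i (Nat.lt_succ_of_lt hi)
  exact ⟨heq.trans (Function.update_of_ne hi.ne _ _), hle⟩

theorem push {f : Γ → ℕ} (hf : ∀ K ρ, Fits g D K ρ → f g ≤ K) (hv : v ≤ f g)
    (h : Fits g ((D + 1) * D') K ρ) : Fits (g, v) D' K (Function.update ρ (depth Γ) v) := by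
  obtain ⟨M, hM, hρ, hK⟩ := h
  have hM' : M ≤ M ^ (D + 1) := Nat.le_self_pow (by omega) M
  have hfM : f g ≤ M ^ (D + 1) :=
    (hf _ ρ ⟨M, hM, hρ, le_rfl⟩).trans (Nat.pow_le_pow_right (by omega) (by omega))
  refine ⟨M ^ (D + 1), hM.trans hM', fun i (hi : i < depth Γ + 1) => ?_, pow_mul M _ _ ▸ hK⟩
  rcases Nat.lt_succ_iff_lt_or_eq.mp hi with hi | rfl
  · rw [Function.update_of_ne hi.ne]
    exact ⟨(hρ i hi).1.trans (Function.update_of_ne hi.ne _ _).symm, (hρ i hi).2.trans hM'⟩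
  · rw [Function.update_self]
    exact ⟨(Function.update_self (depth Γ) v (env g)).symm, hv.trans hfM⟩

end Fits

end Ctx

open Ctx Prog Store Function

variable {A Γ : Type} [Ctx A Γ]

/-- On contexts that fit, `p` stores the value of `f` in the register `e`, using the registers from
`e` on. -/
def Prog.Computes {k : ℕ} (p : Prog A k) (D e : ℕ) (f : Γ → ℕ) : Prop :=
  ∀ g K ρ, Fits g D K ρ → Triple (inp g) (K.size + 3) p (Holds K Set.univ e ρ)
    (Holds K Set.univ (e + 1) (update ρ e (f g)))

/-- Polynomially bounded functions of the context that are computed by programs with finitely many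
registers. -/
def LogFun (f : Γ → ℕ) : Prop :=
  ∃ w D, (∀ g K ρ, Fits g D K ρ → f g ≤ K) ∧
    ∀ e k, depth Γ ≤ e → e + w < k → ∃ p : Prog A k, p.Computes D e f

/-- On contexts that fit, `p` sets the flag to the truth value of `P`, using the registers above the
variables of the context. -/
def Prog.Tests {k : ℕ} (p : Prog A k) (D : ℕ) (P : Γ → Prop) : Prop :=
  ∀ g K ρ, Fits g D K ρ → Triple (inp g) (K.size + 3) p (Holds K Set.univ (depth Γ) ρ)
    fun s => s.Holds K Set.univ (depth Γ) ρ ∧ (s.flag = true ↔ P g)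

/-- Predicates of the context that are decided by programs with finitely many registers of
polynomial size. -/
def LogPred (P : Γ → Prop) : Prop :=
  ∃ w D, ∀ k, depth Γ + w < k → ∃ p : Prog A k, p.Tests D P

variable {f f' : Γ → ℕ} {P Q : Γ → Prop}

theorem Prog.Computes.mono {k D D' e : ℕ} {p : Prog A k} (h : p.Computes D e f) (hD : D ≤ D') :
    p.Computes D' e f := fun g K ρ hg => h g K ρ (hg.mono hD)

namespace LogFun

theorem exists_pair (hf : LogFun f) (hf' : LogFun f') :
    ∃ w D, 1 ≤ D ∧ (∀ g K ρ, Fits g D K ρ → f g ≤ K ∧ f' g ≤ K) ∧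
      ∀ e k, depth Γ ≤ e → e + w < k → ∃ p : Prog A k, ∀ g K ρ, Fits g D K ρ →
        Triple (inp g) (K.size + 3) p (Holds K Set.univ e ρ)
          (Holds K Set.univ (e + 2) (update (update ρ e (f g)) (e + 1) (f' g))) := by
  obtain ⟨w, D, hle, hp⟩ := hf
  obtain ⟨w', D', hle', hp'⟩ := hf'
  refine ⟨w + w' + 1, D + D' + 1, by omega, fun g K ρ hg =>
    ⟨hle g K ρ (hg.mono (by omega)), hle' g K ρ (hg.mono (by omega))⟩, fun e k he hk => ?_⟩
  obtain ⟨p, hp⟩ := hp e k he (by omega)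
  obtain ⟨p', hp'⟩ := hp' (e + 1) k (by omega) (by omega)
  exact ⟨p.seq p', fun g K ρ hg => (hp g K ρ (hg.mono (by omega))).seq
    (hp' g K _ ((hg.mono (by omega)).update he _))⟩

theorem zero : LogFun fun _ : Γ => 0 :=
  ⟨0, 0, fun _ _ _ _ => Nat.zero_le _, fun _ _ _ hk => ⟨_, fun _ _ _ _ => Triple.clr hk⟩⟩

theorem succ (hf : LogFun f) : LogFun fun g => f g + 1 := by
  obtain ⟨w, D, hle, hp⟩ := hf
  have hlt : ∀ g K ρ, Fits g (D + 1) K ρ → f g < K := fun g K ρ hg => by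
    obtain ⟨K', hpos, hg', hK⟩ := hg.exists_two_mul_le
    have := hle g K' ρ hg'
    omega
  refine ⟨w, D + 1, hlt, fun e k he hk => ?_⟩
  obtain ⟨p, hp⟩ := hp e k he hk
  refine ⟨p.seq (Prog.inc ⟨e, by omega⟩), fun g K ρ hg => (hp.mono (by omega) g K ρ hg).seq ?_⟩
  simpa using Triple.inc (ρ := update ρ e (f g)) (r := e) (d := e + 1) (by omega) (by omega)
    (by simpa using hlt g K ρ hg)

theorem const (c : ℕ) : LogFun fun _ : Γ => c := by
  induction c with
  | zero => exact zero
  | succ c ih => exact ih.succ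

theorem add (hf : LogFun f) (hf' : LogFun f') : LogFun fun g => f g + f' g := by
  obtain ⟨w, D, -, hle, hp⟩ := hf.exists_pair hf'
  have hadd : ∀ g K ρ, Fits g (D + 1) K ρ → f g + f' g ≤ K := fun g K ρ hg => by
    obtain ⟨K', -, hg', hK⟩ := hg.exists_two_mul_le
    have := hle g K' ρ hg'
    omega
  refine ⟨w + 2, D + 1, hadd, fun e k he hk => ?_⟩
  obtain ⟨p, hp⟩ := hp e k he (by omega)
  refine ⟨p.seq (Prog.addTo ⟨e, by omega⟩ ⟨e + 1, by omega⟩ ⟨e + 2, by omega⟩), fun g K ρ hg =>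
    (hp g K ρ (hg.mono (by omega))).seq <| (Triple.addTo (r := e) (s := e + 1) (d := e + 2)
      (by omega) (by omega) (by omega) (by omega) (by simpa using hadd g K ρ hg)).mono
        (fun _ hs => hs) fun s hs => hs.mono (by omega) subset_rfl fun i hi => ?_⟩
  rcases Nat.lt_succ_iff_lt_or_eq.mp hi with hi | rfl
  · rw [update_of_ne hi.ne, update_of_ne (by omega), update_of_ne hi.ne, update_of_ne hi.ne]
  · simp

theorem mul (hf : LogFun f) (hf' : LogFun f') : LogFun fun g => f g * f' g := by
  obtain ⟨w, D, -, hle, hp⟩ := hf.exists_pair hf'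
  have hmul : ∀ g K ρ, Fits g (D + D) K ρ → f g * f' g ≤ K := fun g K ρ hg => by
    obtain ⟨K₁, K₂, h₁, h₂, hK⟩ := hg.exists_mul_le
    exact (Nat.mul_le_mul (hle g K₁ ρ h₁).1 (hle g K₂ ρ h₂).2).trans hK
  refine ⟨w + 4, D + D, hmul, fun e k he hk => ?_⟩
  obtain ⟨p, hp⟩ := hp (e + 1) k (by omega) (by omega)
  refine ⟨seq (Prog.clr ⟨e, by omega⟩) <| p.seq <| Prog.mulTo ⟨e, by omega⟩ ⟨e + 1, by omega⟩
    ⟨e + 2, by omega⟩ ⟨e + 3, by omega⟩ ⟨e + 4, by omega⟩, fun g K ρ hg => ?_⟩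
  refine (Triple.clr (by omega)).seq <| (hp g K _ ((hg.mono (by omega)).update he _)).seq <|
    (Triple.mulTo (r := e) (s := e + 1) (t := e + 2) (d := e + 3) (by omega) (by omega) (by omega)
      (by omega) (by omega) (by omega) ?_ ?_).mono (fun _ hs => hs)
      fun s hs => hs.mono (by omega) subset_rfl fun i hi => ?_
  · simpa [update_of_ne (show e ≠ e + 1 + 1 by omega)] using hmul g K ρ hg
  · simpa using (hle g K ρ (hg.mono (by omega))).2
  · simp only [update_apply]
    split_ifs <;> omega

theorem snd : LogFun fun p : Γ × ℕ => p.2 := by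
  have hdepth : depth (Γ × ℕ) = depth Γ + 1 := rfl
  have hval : ∀ (g : Γ × ℕ) D K ρ, Fits g D K ρ → ρ (depth Γ) = g.2 := fun g D K ρ hg => by
    obtain ⟨M, -, hρ, -⟩ := hg
    exact (hρ _ (Nat.lt_succ_self _)).1.trans (update_self _ _ _)
  have hle : ∀ (g : Γ × ℕ) K ρ, Fits g 1 K ρ → g.2 ≤ K := fun g K ρ hg =>
    hval g 1 K ρ hg ▸ hg.le le_rfl (Nat.lt_succ_self _)
  refine ⟨1, 1, hle, fun e k he hk => ⟨seq (Prog.clr ⟨e, by omega⟩)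
    (Prog.addTo ⟨e, by omega⟩ ⟨depth Γ, by omega⟩ ⟨e + 1, by omega⟩), fun g K ρ hg =>
      (Triple.clr (by omega)).seq <| (Triple.addTo (by omega) (by omega) (by omega) (by omega)
        ?_).mono (fun _ hs => hs) fun s hs => hs.mono le_rfl subset_rfl fun i _ => ?_⟩⟩
  · simpa [update_of_ne (show depth Γ ≠ e by omega), hval g 1 K ρ hg] using hle g K ρ hg
  · simp [update_of_ne (show depth Γ ≠ e by omega), hval g 1 K ρ hg]

theorem fst (hf : LogFun f) : LogFun fun p : Γ × ℕ => f p.1 := by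
  obtain ⟨w, D, hle, hp⟩ := hf
  refine ⟨w, D, fun g K ρ hg => hle g.1 K ρ hg.fst, fun e k he hk => ?_⟩
  obtain ⟨p, hp⟩ := hp e k (Nat.le_of_succ_le he) hk
  exact ⟨p, fun g K ρ hg => hp g.1 K ρ hg.fst⟩

theorem length : LogFun fun g : Γ => (inp g).length := by
  have hle : ∀ (g : Γ) K ρ, Fits g 1 K ρ → (inp g).length ≤ K := fun g K ρ hg =>
    (Nat.le_add_right _ 2).trans (hg.length_add_two_le le_rfl)
  exact ⟨0, 1, hle, fun e _ _ hk =>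
    ⟨Prog.length ⟨e, hk⟩, fun g K ρ hg => Triple.length hk (hle g K ρ hg)⟩⟩

theorem sum {ι : Type} (s : Finset ι) {f : ι → Γ → ℕ} (h : ∀ i ∈ s, LogFun (f i)) :
    LogFun fun g => ∑ i ∈ s, f i g := by
  classical
  induction s using Finset.induction_on with
  | empty => simpa using const 0
  | insert a s ha ih =>
    simp only [Finset.sum_insert ha]
    exact (h a (by simp)).add (ih fun i hi => h i (by simp [hi]))

end LogFun

end LogFun

section LogPred

open Ctx Prog Store Function

variable {A Γ : Type} [Ctx A Γ] {f f' : Γ → ℕ} {P Q : Γ → Prop}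

theorem Prog.Triple.negate {k H d K : ℕ} {x : List A} {p : Prog A k} {P : Store k → Prop}
    {pos : Set ℕ} {ρ : ℕ → ℕ} {c : Prop}
    (h : Triple x H p P fun s => s.Holds K pos d ρ ∧ (s.flag = true ↔ c)) :
    Triple x H (p.seq (Prog.setFlag fun _ _ b => !b)) P
      fun s => s.Holds K pos d ρ ∧ (s.flag = true ↔ ¬ c) := by
  refine h.seq ?_
  rintro s hs ⟨⟨q, hq, b, reg, rfl, hK, hρ⟩, hflag⟩
  obtain ⟨s', hs', rfl, hr⟩ := triple_setFlag (t := fun _ _ b => !b) _ hs rfl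
  refine ⟨_, hs', ⟨⟨q, hq, !b, reg, rfl, hK, hρ⟩, ?_⟩, hr⟩
  rw [← hflag]
  cases b <;> simp [Store.ofReg]

namespace LogPred

theorem congr (h : LogPred P) (hPQ : ∀ g, P g ↔ Q g) : LogPred Q := by
  obtain rfl : P = Q := funext fun g => propext (hPQ g)
  exact h

theorem eq (hf : LogFun f) (hf' : LogFun f') : LogPred fun g => f g = f' g := by
  obtain ⟨w, D, -, -, hp⟩ := hf.exists_pair hf'
  refine ⟨w + 1, D, fun k hk => ?_⟩
  obtain ⟨p, hp⟩ := hp (depth Γ) k le_rfl (by omega)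
  refine ⟨p.seq (Prog.eqt ⟨depth Γ, by omega⟩ ⟨depth Γ + 1, by omega⟩), fun g K ρ hg =>
    (hp g K ρ hg).seq <| (Triple.eqt (d := depth Γ + 2) (by omega) (by omega) (by omega)
      (by omega)).mono (fun _ hs => hs) fun s hs => ⟨hs.1.mono (by omega) subset_rfl fun i hi => ?_,
        by simpa using hs.2⟩⟩
  rw [update_of_ne (by omega), update_of_ne hi.ne]

theorem not (h : LogPred P) : LogPred fun g => ¬ P g := by
  obtain ⟨w, D, hp⟩ := h
  refine ⟨w, D, fun k hk => ?_⟩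
  obtain ⟨p, hp⟩ := hp k hk
  exact ⟨_, fun g K ρ hg => (hp g K ρ hg).negate⟩

theorem and (h : LogPred P) (h' : LogPred Q) : LogPred fun g => P g ∧ Q g := by
  obtain ⟨w, D, hp⟩ := h
  obtain ⟨w', D', hp'⟩ := h'
  refine ⟨w + w', D + D', fun k hk => ?_⟩
  obtain ⟨p, hp⟩ := hp k (by omega)
  obtain ⟨p', hp'⟩ := hp' k (by omega)
  refine ⟨p.seq (ite (fun _ _ b => b) p' skip), fun g K ρ hg =>
    (hp g K ρ (hg.mono (by omega))).seq <| .ite (fun s hs hP => ?_)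
      (.skip fun s hs => ⟨hs.1.1, hs.1.2.trans ?_⟩)⟩
  · obtain ⟨s', hs', ⟨hholds, hflag⟩, hr⟩ := hp' g K ρ (hg.mono (by omega)) s hs hP.1.1
    exact ⟨s', hs', ⟨hholds, hflag.trans (and_iff_right (hP.1.2.mp hP.2)).symm⟩, hr⟩
  · have hP : ¬ P g := by rw [← hs.1.2, hs.2]; exact Bool.false_ne_true
    simp [hP]

theorem or (h : LogPred P) (h' : LogPred Q) : LogPred fun g => P g ∨ Q g :=
  (h.not.and h'.not).not.congr fun g => by tauto

theorem imp (h : LogPred P) (h' : LogPred Q) : LogPred fun g => P g → Q g :=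
  (h.and h'.not).not.congr fun g => by tauto

theorem iff (h : LogPred P) (h' : LogPred Q) : LogPred fun g => (P g ↔ Q g) :=
  ((h.imp h').and (h'.imp h)).congr fun g => by tauto

theorem const (p : Prop) : LogPred fun _ : Γ => p := by
  by_cases hp : p
  · exact (eq (.const 0) (.const 0)).congr fun _ => by simp [hp]
  · exact (eq (.const 0) (.const 1)).congr fun _ => by simp [hp]

theorem exists_mem {ι : Type} {s : Set ι} (hs : s.Finite) {P : ι → Γ → Prop}
    (h : ∀ i ∈ s, LogPred (P i)) : LogPred fun g => ∃ i ∈ s, P i g := by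
  induction s, hs using Set.Finite.induction_on with
  | empty => exact (const False).congr fun _ => by simp
  | insert _ _ ih =>
    exact ((h _ (Set.mem_insert _ _)).or (ih fun i hi => h i (Set.mem_insert_of_mem _ hi))).congr
      fun g => by simp

theorem exists_finite {ι : Type} [Finite ι] {P : ι → Γ → Prop} (h : ∀ i, LogPred (P i)) :
    LogPred fun g => ∃ i, P i g :=
  (exists_mem Set.finite_univ fun i _ => h i).congr fun g => by simp

theorem forall_finite {ι : Type} [Finite ι] {P : ι → Γ → Prop} (h : ∀ i, LogPred (P i)) :
    LogPred fun g => ∀ i, P i g :=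
  (exists_finite fun i => (h i).not).not.congr fun g => by simp

theorem exists_lt {P : Γ → ℕ → Prop} (hf : LogFun f) (hP : LogPred fun p : Γ × ℕ => P p.1 p.2) :
    LogPred fun g => ∃ v < f g, P g v := by
  have hhalt := (eq .snd hf.fst).or hP
  have hfound := (eq .snd hf.fst).not
  obtain ⟨w, D, hle, -⟩ := hf
  obtain ⟨w₁, D₁, hp₁⟩ := hhalt
  obtain ⟨w₂, D₂, hp₂⟩ := hfound
  have hdepth : depth (Γ × ℕ) = depth Γ + 1 := rfl
  refine ⟨1 + w₁ + w₂, (D + 1) * (D₁ + D₂ + 1), fun k hk => ?_⟩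
  obtain ⟨p, hp⟩ := hp₁ k (by omega)
  obtain ⟨q, hq⟩ := hp₂ k (by omega)
  refine ⟨seq (Prog.clr ⟨depth Γ, by omega⟩) <|
    seq (loopUntil p (Prog.inc ⟨depth Γ, by omega⟩)) q, fun g K ρ hg => ?_⟩
  obtain ⟨m, hm, hmin⟩ : ∃ m, (m = f g ∨ P g m) ∧ ∀ j < m, ¬ (j = f g ∨ P g j) := by
    classical
    have hex : ∃ m, m = f g ∨ P g m := ⟨_, Or.inl rfl⟩
    exact ⟨Nat.find hex, Nat.find_spec hex, fun j => Nat.find_min hex⟩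
  have hmf : m ≤ f g := le_of_not_gt fun h => hmin _ h (Or.inl rfl)
  have hfit : ∀ j ≤ m, Fits (g, j) (D₁ + D₂ + 1) K (update ρ (depth Γ) j) := fun j hj =>
    Fits.push (hle g) (hj.trans hmf) hg
  have hiff : ∀ j ≤ m, (j = f g ∨ P g j) ↔ j = m := fun j hj =>
    ⟨fun h => hj.eq_of_not_lt fun h' => hmin j h' h, fun h => h ▸ hm⟩
  have hexists : ¬ m = f g ↔ ∃ v < f g, P g v :=
    ⟨fun h => ⟨m, hmf.lt_of_ne h, hm.resolve_left h⟩,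
      fun ⟨v, hv, hPv⟩ h => hmin v (hv.trans_eq h.symm) (Or.inr hPv)⟩
  refine (Triple.clr (by omega)).seq <| (Triple.loopUntil
    (fun j => Holds K Set.univ (depth Γ + 1) (update ρ (depth Γ) j)) m
    (fun j hj => (hp (g, j) K _ ((hfit j hj).mono (by omega))).mono (fun _ hs => hs)
      fun s hs => ⟨hs.1, hs.2.trans (hiff j hj)⟩)
    fun j hj => ?_).seq <| (hq (g, m) K _ ((hfit m le_rfl).mono (by omega))).mono (fun _ hs => hs.1)
      fun s hs => ⟨hs.1.mono (by omega) subset_rfl fun i hi => update_of_ne hi.ne _ _,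
        hs.2.trans hexists⟩
  have := (hfit m le_rfl).le (by omega) (i := depth Γ) (by omega)
  simp only [update_self] at this
  simpa using Triple.inc (d := depth Γ + 1) (r := depth Γ) (ρ := update ρ (depth Γ) j)
    (by omega) (by omega) (by rw [update_self]; omega)

theorem forall_lt {P : Γ → ℕ → Prop} (hf : LogFun f) (hP : LogPred fun p : Γ × ℕ => P p.1 p.2) :
    LogPred fun g => ∀ v < f g, P g v :=
  (exists_lt (P := fun g v => ¬ P g v) hf hP.not).not.congr fun g => by push Not; rfl

theorem exists_le {P : Γ → ℕ → Prop} (hP : LogPred fun p : Γ × ℕ => P p.1 p.2)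
    (hle : ∀ g v, P g v → v ≤ (inp g).length) : LogPred fun g => ∃ v, P g v :=
  (exists_lt LogFun.length.succ hP).congr fun g =>
    ⟨fun ⟨v, _, h⟩ => ⟨v, h⟩, fun ⟨v, h⟩ => ⟨v, Nat.lt_succ_of_le (hle g v h), h⟩⟩

theorem lt (hf : LogFun f) (hf' : LogFun f') : LogPred fun g => f g < f' g :=
  (exists_lt (P := fun g v => v = f g) hf' (eq .snd hf.fst)).congr fun g => by simp

theorem le (hf : LogFun f) (hf' : LogFun f') : LogPred fun g => f g ≤ f' g :=
  (lt hf' hf).not.congr fun g => by simp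

theorem getElem?_eq_some (a : A) (hf : LogFun f) : LogPred fun g => (inp g)[f g]? = some a := by
  classical
  obtain ⟨w, D, hle, hp⟩ := hf
  refine ⟨w + 1, D, fun k hk => ?_⟩
  obtain ⟨p, hp⟩ := hp (depth Γ) k le_rfl (by omega)
  refine ⟨p.seq <| seq (Prog.seek ⟨depth Γ, by omega⟩ ⟨depth Γ + 1, by omega⟩) <|
    Prog.setFlag fun b _ _ => match b with | .sym b => decide (b = a) | _ => false,
    fun g K ρ hg => ?_⟩
  refine (hp g K ρ hg).seq <| (Triple.seek (Nat.lt_succ_self _) (by omega)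
    (by simpa using hle g K ρ hg)).seq <| Triple.setFlag.mono (fun _ hs => hs) fun s hs =>
      ⟨hs.1.mono (by omega) (Set.subset_univ _) fun i hi => update_of_ne hi.ne _ _, hs.2 ▸ ?_⟩
  rw [update_self]
  rcases lt_or_ge (f g) (inp g).length with h | h
  · rw [min_eq_left (by omega)]
    simp [OfflineTM.readInput, h]
  · rw [min_eq_right (by omega)]
    simp [OfflineTM.readInput, h]

end LogPred

/-- `π` recovers a context from a richer one. -/
structure Ctx.Forgets {Γ' : Type} [Ctx A Γ'] (π : Γ' → Γ) : Prop where
  inp_eq : ∀ g, inp (π g) = inp g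
  logFun : ∀ {f : Γ → ℕ}, LogFun f → LogFun fun g => f (π g)

namespace Ctx.Forgets

theorem refl : Forgets fun g : Γ => g := ⟨fun _ => rfl, fun hf => hf⟩

theorem fst {Γ' : Type} [Ctx A Γ'] {π : Γ' → Γ} (hπ : Forgets π) :
    Forgets fun p : Γ' × ℕ => π p.1 :=
  ⟨fun p => hπ.inp_eq p.1, fun hf => (hπ.logFun hf).fst⟩

theorem comp {Γ' Γ'' : Type} [Ctx A Γ'] [Ctx A Γ''] {π : Γ' → Γ} {π' : Γ'' → Γ'} (hπ : Forgets π)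
    (hπ' : Forgets π') : Forgets fun g => π (π' g) :=
  ⟨fun g => (hπ.inp_eq _).trans (hπ'.inp_eq g), fun hf => hπ'.logFun (hπ.logFun hf)⟩

end Ctx.Forgets

/-- Predicates of a context and a vector of numbers that are decidable in logarithmic space in all
richer contexts in which the vector is computable. -/
def LogVecPred {N : ℕ} (P : Γ → (Fin N → ℕ) → Prop) : Prop :=
  ∀ (Γ' : Type) [Ctx A Γ'] (π : Γ' → Γ), Forgets π → ∀ f : Fin N → Γ' → ℕ, (∀ i, LogFun (f i)) →
    LogPred fun g => P (π g) fun i => f i g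

theorem LogVecPred.exists {N : ℕ} {Γ : Type} [Ctx A Γ] {P : Γ → (Fin N → ℕ) → Prop}
    (hP : LogVecPred P) (hle : ∀ g v, P g v → ∀ i, v i ≤ (inp g).length) :
    LogPred fun g => ∃ v, P g v := by
  induction N generalizing Γ with
  | zero =>
    exact (hP Γ _ .refl (fun i => i.elim0) fun i => i.elim0).congr fun g =>
      ⟨fun h => ⟨_, h⟩, fun ⟨v, hv⟩ => (congrArg (P g) (Subsingleton.elim v _)).mp hv⟩
  | succ N ih =>
    have htail : LogVecPred fun (p : Γ × ℕ) (v : Fin N → ℕ) => P p.1 (Fin.cons p.2 v) := by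
      intro Γ' _ π hπ f hf
      refine (hP Γ' _ (Forgets.refl.fst.comp hπ) (Fin.cons (fun g => (π g).2) f)
        (Fin.cases (hπ.logFun .snd) hf)).congr fun g => iff_of_eq (congrArg _ ?_)
      exact funext (Fin.cases rfl fun _ => rfl)
    refine (LogPred.exists_le (P := fun g a => ∃ v : Fin N → ℕ, P g (Fin.cons a v))
      (ih htail fun p v h i => hle _ _ h i.succ) fun g a ⟨v, h⟩ => hle _ _ h 0).congr fun g => ?_
    exact (Fin.exists_fin_succ_pi (P := P g)).symm

theorem size_pow_le (n D : ℕ) : ((n + 2) ^ D).size + 3 ≤ (2 * D + 4) * (Nat.log 2 n + 1) := by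
  have hn : n + 2 ≤ 2 ^ (Nat.log 2 n + 2) := by
    have := Nat.lt_pow_succ_log_self (b := 2) (by norm_num) n
    have := Nat.one_le_two_pow (n := Nat.log 2 n)
    simp only [pow_succ] at *
    omega
  have hsize : ((n + 2) ^ D).size ≤ (Nat.log 2 n + 2) * D + 1 := by
    rw [Nat.size_le, pow_succ, pow_mul]
    have := Nat.pow_le_pow_left hn D
    have : 0 < (2 ^ (Nat.log 2 n + 2)) ^ D := by positivity
    omega
  nlinarith [Nat.zero_le (Nat.log 2 n * D)]

theorem LogPred.inLogspace {A : Type} [Finite A] {L : Language A}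
    (h : LogPred fun x : List A => x ∈ L) : InLogspace L := by
  obtain ⟨w, D, hp⟩ := h
  obtain ⟨p, hp⟩ := hp (w + 1) (by simp [depth])
  refine ⟨(seq (stepOn Finset.univ .stay fun _ => .mark) p).toTM, 2 * D + 4,
    decidesInSpace (fun n => Nat.succ_pos (((n + 2) ^ D).size + 2)) (fun n => size_pow_le n D)
      fun x => ?_⟩
  obtain ⟨s, -, ⟨-, hflag⟩, hr⟩ := ((triple_mark_tapes (Nat.succ_pos _)).seq <|
    (hp x ((x.length + 2) ^ D) (fun _ => 0) ⟨x.length + 2, le_rfl, by simp [depth], le_rfl⟩).mono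
      (fun s hs => ⟨0, trivial, false, _, hs, fun _ => Nat.zero_le _, fun _ _ => by simp⟩)
      fun _ hs => hs) _ ⟨Nat.zero_le _, fun _ => Nat.succ_pos _⟩ rfl
  exact ⟨s, hr, hflag⟩

end LogPred

/-! ### Chains of unary operators -/

theorem exists_short_sublist_foldr_eq {A S : Type*} [Fintype S] (f : A → S → S) (s : S)
    (c : List A) :
    ∃ c' : List A, c'.Sublist c ∧ c'.length < Fintype.card S ∧ c'.foldr f s = c.foldr f s := by
  induction h : c.length using Nat.strong_induction_on generalizing c with
  | _ n ih =>
    subst h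
    by_cases hc : c.length < Fintype.card S
    · exact ⟨c, List.Sublist.refl c, hc, rfl⟩
    obtain ⟨i, j, hij, heq⟩ : ∃ i j : Fin (Fintype.card S + 1), i < j ∧
        (c.drop i).foldr f s = (c.drop j).foldr f s := by
      obtain ⟨i, j, hne, heq⟩ := Fintype.exists_ne_map_eq_of_card_lt
        (fun i : Fin (Fintype.card S + 1) => (c.drop i).foldr f s) (by simp)
      rcases hne.lt_or_gt with hlt | hlt
      · exact ⟨i, j, hlt, heq⟩
      · exact ⟨j, i, hlt, heq.symm⟩
    have hij' : (i : ℕ) < j := hij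
    have hshorter : (c.take i ++ c.drop j).length < c.length := by
      have := j.2
      simp only [List.length_append, List.length_take, List.length_drop]
      omega
    have hsub : (c.take i ++ c.drop j).Sublist c := by
      conv_rhs => rw [← List.take_append_drop i c]
      exact (List.Sublist.refl _).append (List.drop_sublist_drop_left c hij'.le)
    obtain ⟨c', hc', hlen, hfold⟩ := ih _ hshorter _ rfl
    refine ⟨c', hc'.trans hsub, hlen, ?_⟩
    rw [hfold, List.foldr_append, ← heq, ← List.foldr_append, List.take_append_drop]

namespace UnOp

/-- The action of a unary operator on predicates of positions. -/
def sem : UnOp → (ℕ → Prop) → ℕ → Prop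
  | .not, f, i => ¬ f i
  | .X, f, i => f (i + 1)
  | .F, f, i => ∃ j, f (i + j)
  | .G, f, i => ∀ j, f (i + j)

end UnOp

namespace LTL

variable {α : Type}

/-- The application of a chain of unary operators, the head of the list being the outermost one. -/
def chain (c : List UnOp) (φ : LTL α) : LTL α := c.foldr un φ

theorem chain_append (c d : List UnOp) (φ : LTL α) : chain (c ++ d) φ = chain c (chain d φ) :=
  List.foldr_append

theorem suffix_suffix (w : ℕ → Set α) (i j : ℕ) : suffix (suffix w i) j = suffix w (i + j) := by
  funext k
  simp only [suffix, Nat.add_assoc]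

theorem suffix_zero (w : ℕ → Set α) : suffix w 0 = w := by
  funext k
  simp only [suffix, Nat.zero_add]

theorem sat_un (w : ℕ → Set α) (o : UnOp) (φ : LTL α) (i : ℕ) :
    Sat (suffix w i) (un o φ) ↔ o.sem (fun j => Sat (suffix w j) φ) i := by
  cases o <;> simp only [Sat, UnOp.sem, suffix_suffix]

end LTL

/-- The combinations of `F` and `G` up to equivalence: `F F = F`, `G G = G`, `F G F = G F` and
`G F G = F G`. -/
inductive Modality
  | id | F | G | FG | GF
  deriving DecidableEq

namespace Modality

instance : Fintype Modality where
  elems := {.id, .F, .G, .FG, .GF}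
  complete := by intro M; cases M <;> decide

/-- The action of a modality on predicates of positions. -/
def sem : Modality → (ℕ → Prop) → ℕ → Prop
  | id, f, i => f i
  | F, f, i => ∃ j, f (i + j)
  | G, f, i => ∀ j, f (i + j)
  | FG, f, i => ∃ j, ∀ l, f (i + j + l)
  | GF, f, i => ∀ j, ∃ l, f (i + j + l)

/-- The modality obtained by moving a negation through. -/
def dual : Modality → Modality
  | id => id | F => G | G => F | FG => GF | GF => FG

/-- The composition with `F` on the left. -/
def compF : Modality → Modality
  | id => F | F => F | G => FG | FG => FG | GF => GF

/-- The composition with `G` on the left. -/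
def compG : Modality → Modality
  | id => G | F => GF | G => G | FG => FG | GF => GF

theorem dual_compF_dual (M : Modality) : M.dual.compF.dual = M.compG := by cases M <;> rfl

theorem sem_dual (M : Modality) (f : ℕ → Prop) (i : ℕ) :
    M.dual.sem f i ↔ ¬ M.sem (fun j => ¬ f j) i := by
  cases M <;> simp [dual, sem]

theorem sem_compF (M : Modality) (f : ℕ → Prop) (i : ℕ) :
    M.compF.sem f i ↔ ∃ j, M.sem f (i + j) := by
  cases M with
  | id => rfl
  | G => rfl
  | F | FG =>
    constructor
    · rintro ⟨j, h⟩
      exact ⟨0, j, h⟩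
    · rintro ⟨j, l, h⟩
      exact ⟨j + l, by rwa [← Nat.add_assoc]⟩
  | GF =>
    refine ⟨fun h => ⟨0, h⟩, ?_⟩
    rintro ⟨j, h⟩ k
    obtain ⟨l, hl⟩ := h k
    exact ⟨j + l, by convert hl using 1; omega⟩

theorem sem_compG (M : Modality) (f : ℕ → Prop) (i : ℕ) :
    M.compG.sem f i ↔ ∀ j, M.sem f (i + j) := by
  rw [← dual_compF_dual, sem_dual, sem_compF]
  simp only [sem_dual, not_exists, not_not]

/-- A modality applied to a predicate (`false`) or to its negation (`true`). -/
def signedSem (m : Bool × Modality) (f : ℕ → Prop) : ℕ → Prop :=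
  m.2.sem (if m.1 then fun i => ¬ f i else f)

/-- The composition of a signed modality with a unary operator on the left, `X` being ignored. -/
def push : UnOp → Bool × Modality → Bool × Modality
  | .not, m => (!m.1, m.2.dual)
  | .X, m => m
  | .F, m => (m.1, m.2.compF)
  | .G, m => (m.1, m.2.compG)

/-- The signed modality of a chain, `X` being ignored. -/
def ofChain (c : List UnOp) : Bool × Modality := c.foldr push (false, id)

theorem signedSem_push {o : UnOp} (ho : o ≠ .X) (m : Bool × Modality) (f : ℕ → Prop) (i : ℕ) :
    signedSem (push o m) f i ↔ o.sem (signedSem m f) i := by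
  obtain ⟨b, M⟩ := m
  cases o with
  | not => cases b <;> simp [signedSem, push, UnOp.sem, sem_dual]
  | X => exact absurd rfl ho
  | F => exact sem_compF _ _ _
  | G => exact sem_compG _ _ _

theorem ofChain_filter_ne_X (c : List UnOp) : ofChain (c.filter (· ≠ .X)) = ofChain c := by
  induction c with
  | nil => rfl
  | cons o c ih =>
    cases o with
    | X => exact ih
    | not => exact congrArg (push .not) ih
    | F => exact congrArg (push .F) ih
    | G => exact congrArg (push .G) ih

theorem ofChain_replicate_X_append (k : ℕ) (c : List UnOp) :
    ofChain (List.replicate k .X ++ c) = ofChain c := by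
  induction k with
  | zero => rfl
  | succ _ ih => exact ih

end Modality

namespace LTL

variable {α : Type}

theorem sat_chain (w : ℕ → Set α) (c : List UnOp) (φ : LTL α) (i : ℕ) :
    Sat (suffix w i) (chain c φ) ↔
      Modality.signedSem (Modality.ofChain c) (fun j => Sat (suffix w j) φ) (i + c.count .X) := by
  induction c generalizing i with
  | nil => rfl
  | cons o c ih =>
    change Sat (suffix w i) (un o (chain c φ)) ↔
      Modality.signedSem (Modality.push o (Modality.ofChain c)) _ _
    rw [sat_un]
    by_cases ho : o = .X
    · subst ho
      simp only [UnOp.sem, ih, List.count_cons_self]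
      rw [Nat.add_right_comm, Nat.add_assoc i]
      rfl
    · rw [List.count_cons_of_ne ho, Modality.signedSem_push ho]
      cases o <;> simp only [UnOp.sem, ih, Nat.add_right_comm]

theorem length_filter_ne_X (c : List UnOp) :
    (c.filter (· ≠ .X)).length + c.count .X = c.length := by
  induction c with
  | nil => rfl
  | cons o c ih => cases o <;> simp <;> simp at ih <;> omega

-- The nine in the bound is one less than the number of signed modalities.
theorem exists_short_chain (c : List UnOp) : ∃ c' : List UnOp, c'.length ≤ 9 ∧
    c'.length + c.count .X ≤ c.length ∧ c' ⊆ c ∧ ∀ {α : Type} (w : ℕ → Set α) (φ : LTL α),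
      Sat w (chain c φ) ↔ Sat w (chain (List.replicate (c.count .X) .X ++ c') φ) := by
  obtain ⟨c', hsub, hshort, hfold⟩ :=
    exists_short_sublist_foldr_eq Modality.push (false, .id) (c.filter (· ≠ .X))
  have hsem : Modality.ofChain c' = Modality.ofChain c :=
    hfold.trans (Modality.ofChain_filter_ne_X c)
  have hX : c'.count .X = 0 := List.count_eq_zero.2 fun h => by simpa using hsub.subset h
  refine ⟨c', Nat.le_of_lt_succ hshort, ?_, fun o ho => List.mem_of_mem_filter (hsub.subset ho),
    fun w φ => ?_⟩
  · rw [← length_filter_ne_X c]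
    exact Nat.add_le_add_right hsub.length_le _
  · rw [← suffix_zero w, sat_chain, sat_chain, Modality.ofChain_replicate_X_append, hsem,
      List.count_append, hX, List.count_replicate_self, Nat.add_zero]

end LTL

/-! ### Sub-formulas as a graph -/

namespace LTL

variable {α : Type}

/-- Whether the outermost operator is unary. -/
def isUn : LTL α → Bool
  | un _ _ => true
  | _ => false

section Operands

variable [DecidableEq α]

/-- The immediate sub-formulas. -/
def operands : LTL α → Finset (LTL α)
  | atom _ => ∅
  | un _ φ => {φ}
  | binTemp _ φ ψ => {φ, ψ}
  | binLog _ φ ψ => {φ, ψ}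

theorem card_operands_le (φ : LTL α) : φ.operands.card ≤ 2 := by
  cases φ <;> simp [operands, Finset.card_le_two]

theorem sizeOf_lt_of_mem_operands {φ ψ : LTL α} (h : ψ ∈ φ.operands) : sizeOf ψ < sizeOf φ := by
  cases φ with
  | atom p => simp [operands] at h
  | un o φ => simp_all [operands]
  | binTemp o φ φ' | binLog o φ φ' =>
    simp only [operands, Finset.mem_insert, Finset.mem_singleton] at h
    rcases h with rfl | rfl <;>
      simp only [binTemp.sizeOf_spec, binLog.sizeOf_spec] <;> omega

theorem operands_induction {P : LTL α → Prop}
    (h : ∀ φ, (∀ ψ ∈ φ.operands, P ψ) → P φ) (φ : LTL α) : P φ := by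
  induction φ with
  | atom p => exact h _ (by simp [operands])
  | un o φ ih => exact h _ (by simpa [operands] using ih)
  | binTemp o φ ψ ih ih' | binLog o φ ψ ih ih' => exact h _ (by simpa [operands] using ⟨ih, ih'⟩)

theorem UsesOnly.of_mem_operands {Ut : Set UnOp} {Bt : Set BinTempOp} {Bl : Set BinLogOp}
    {φ ψ : LTL α} (hφ : φ.UsesOnly Ut Bt Bl) (h : ψ ∈ φ.operands) : ψ.UsesOnly Ut Bt Bl := by
  cases φ with
  | atom p => simp [operands] at h
  | un o φ =>
    rw [Finset.mem_singleton.1 h]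
    exact hφ.2
  | binTemp o φ φ' | binLog o φ φ' =>
    simp only [operands, Finset.mem_insert, Finset.mem_singleton] at h
    rcases h with rfl | rfl
    · exact hφ.2.1
    · exact hφ.2.2

theorem mem_subF {φ ψ : LTL α} : ψ ∈ φ.subF ↔ ψ = φ ∨ ∃ χ ∈ φ.operands, ψ ∈ χ.subF := by
  cases φ <;> simp [subF, operands]

theorem self_mem_subF (φ : LTL α) : φ ∈ φ.subF := mem_subF.2 (.inl rfl)

theorem mem_subF_of_mem_operands {φ χ ψ : LTL α} (hχ : χ ∈ φ.subF) (hψ : ψ ∈ χ.operands) :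
    ψ ∈ φ.subF := by
  induction φ using operands_induction with
  | h φ ih =>
    rcases mem_subF.1 hχ with rfl | ⟨ξ, hξ, hχξ⟩
    · exact mem_subF.2 (.inr ⟨ψ, hψ, self_mem_subF ψ⟩)
    · exact mem_subF.2 (.inr ⟨ξ, hξ, ih ξ hξ hχξ⟩)

theorem UsesOnly.of_mem_subF {Ut : Set UnOp} {Bt : Set BinTempOp} {Bl : Set BinLogOp}
    {φ ψ : LTL α} (hφ : φ.UsesOnly Ut Bt Bl) (h : ψ ∈ φ.subF) : ψ.UsesOnly Ut Bt Bl := by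
  induction φ using operands_induction with
  | h φ ih =>
    rcases mem_subF.1 h with rfl | ⟨χ, hχ, hψ⟩
    · exact hφ
    · exact ih χ hχ (hφ.of_mem_operands hχ) hψ

theorem exists_mem_operands {φ ψ : LTL α} (h : ψ ∈ φ.subF) (hne : ψ ≠ φ) :
    ∃ χ ∈ φ.subF, ψ ∈ χ.operands := by
  induction φ using operands_induction with
  | h φ ih =>
    obtain ⟨χ, hχ, hψ⟩ := (mem_subF.1 h).resolve_left hne
    by_cases hψχ : ψ = χ
    · exact ⟨φ, self_mem_subF φ, hψχ ▸ hχ⟩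
    · obtain ⟨ξ, hξ, hψξ⟩ := ih χ hχ hψ hψχ
      exact ⟨ξ, mem_subF.2 (.inr ⟨χ, hχ, hξ⟩), hψξ⟩

end Operands

section Special

variable [DecidableEq α]

/-- The number of unary sub-formulas of `φ` with operand `ψ`. -/
def unParents (φ ψ : LTL α) : ℕ := (φ.subF.filter fun χ => χ.isUn ∧ ψ ∈ χ.operands).card

/-- The formula itself and the operands of its binary sub-formulas. -/
def binChildren (φ : LTL α) : Finset (LTL α) :=
  insert φ ((φ.subF.filter fun χ => χ.isBin).biUnion operands)

/-- The sub-formulas at which chains of unary operators begin, end or merge. -/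
def special (φ : LTL α) : Finset (LTL α) :=
  φ.binChildren ∪ (φ.subF.filter fun χ => ¬ χ.isUn) ∪ φ.subF.filter fun χ => 2 ≤ unParents φ χ

variable {φ ψ χ : LTL α}

theorem mem_special_of_mem_binChildren (h : ψ ∈ φ.binChildren) : ψ ∈ φ.special :=
  Finset.mem_union_left _ (Finset.mem_union_left _ h)

theorem self_mem_special (φ : LTL α) : φ ∈ φ.special :=
  mem_special_of_mem_binChildren (Finset.mem_insert_self _ _)

theorem mem_special_of_mem_operands (hχ : χ ∈ φ.subF) (hbin : χ.isBin) (hψ : ψ ∈ χ.operands) :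
    ψ ∈ φ.special :=
  mem_special_of_mem_binChildren (Finset.mem_insert_of_mem
    (Finset.mem_biUnion.2 ⟨χ, Finset.mem_filter.2 ⟨hχ, hbin⟩, hψ⟩))

theorem mem_special_of_not_isUn (h : ψ ∈ φ.subF) (hψ : ¬ ψ.isUn) : ψ ∈ φ.special :=
  Finset.mem_union_left _ (Finset.mem_union_right _ (Finset.mem_filter.2 ⟨h, hψ⟩))

theorem unParents_le_one_of_notMem_special (h : ψ ∈ φ.subF) (hψ : ψ ∉ φ.special) :
    unParents φ ψ ≤ 1 := by
  by_contra hlt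
  exact hψ (Finset.mem_union_right _ (Finset.mem_filter.2 ⟨h, not_le.1 hlt⟩))

theorem special_subset (φ : LTL α) : φ.special ⊆ φ.subF := by
  refine Finset.union_subset (Finset.union_subset (Finset.insert_subset (self_mem_subF φ) ?_)
    (Finset.filter_subset _ _)) (Finset.filter_subset _ _)
  exact Finset.biUnion_subset.2 fun χ hχ ψ hψ =>
    mem_subF_of_mem_operands (Finset.mem_filter.1 hχ).1 hψ

theorem sum_unParents_mul (φ : LTL α) (f : LTL α → ℕ) :
    ∑ ψ ∈ φ.subF, unParents φ ψ * f ψ = ∑ χ ∈ φ.subF with χ.isUn, ∑ ψ ∈ χ.operands, f ψ := by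
  simp only [unParents, Finset.card_eq_sum_ones, Finset.sum_mul, one_mul]
  refine Finset.sum_comm' fun ψ χ => ?_
  simp only [Finset.mem_filter]
  exact ⟨fun ⟨_, hχ, hun, hψ⟩ => ⟨hψ, hχ, hun⟩,
    fun ⟨hψ, hχ, hun⟩ => ⟨mem_subF_of_mem_operands hχ hψ, hχ, hun, hψ⟩⟩

theorem sum_unParents (φ : LTL α) :
    ∑ ψ ∈ φ.subF, unParents φ ψ = (φ.subF.filter fun χ => χ.isUn).card := by
  have h := sum_unParents_mul φ fun _ => 1
  simp only [mul_one] at h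
  rw [h, Finset.card_eq_sum_ones]
  refine Finset.sum_congr rfl fun χ hχ => ?_
  have hun := (Finset.mem_filter.1 hχ).2
  cases χ <;> first | rfl | simp [isUn] at hun

theorem card_filter_isUn_add (φ : LTL α) :
    (φ.subF.filter fun χ => χ.isUn).card + (φ.subF.filter fun χ => ¬ χ.isUn).card = φ.size :=
  Finset.card_filter_add_card_filter_not _

theorem card_binChildren_le (φ : LTL α) : φ.binChildren.card ≤ 2 * φ.numBin + 1 := by
  refine (Finset.card_insert_le _ _).trans (Nat.succ_le_succ ?_)
  rw [Nat.mul_comm]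
  exact Finset.card_biUnion_le_card_mul _ _ _ fun χ _ => card_operands_le χ

theorem mem_binChildren_of_unParents_eq_zero (h : ψ ∈ φ.subF) (h0 : unParents φ ψ = 0) :
    ψ ∈ φ.binChildren := by
  by_cases hne : ψ = φ
  · exact hne ▸ Finset.mem_insert_self _ _
  obtain ⟨χ, hχ, hψ⟩ := exists_mem_operands h hne
  refine Finset.mem_insert_of_mem (Finset.mem_biUnion.2 ⟨χ, Finset.mem_filter.2 ⟨hχ, ?_⟩, hψ⟩)
  have hun : ¬ (χ.isUn ∧ ψ ∈ χ.operands) :=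
    Finset.filter_eq_empty_iff.1 (Finset.card_eq_zero.1 h0) hχ
  cases χ <;> simp_all [operands, isBin, isUn]

-- Double counting of the unary edges: merging nodes have a surplus of parents, which the
-- sub-formulas without a unary parent and the non-unary ones have to make up for.
theorem card_special_le (φ : LTL α) : φ.special.card ≤ 2 * (2 * φ.numBin + 1) := by
  have hedges : φ.size + (φ.subF.filter fun χ => 2 ≤ unParents φ χ).card ≤
      (φ.subF.filter fun χ => χ.isUn).card + (φ.subF.filter fun χ => unParents φ χ = 0).card := by
    rw [← sum_unParents, size, Finset.card_eq_sum_ones, Finset.card_filter, Finset.card_filter,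
      ← Finset.sum_add_distrib, ← Finset.sum_add_distrib]
    refine Finset.sum_le_sum fun ψ _ => ?_
    split_ifs <;> omega
  have hzero : (φ.subF.filter fun χ => unParents φ χ = 0).card ≤ φ.binChildren.card :=
    Finset.card_le_card fun ψ hψ =>
      mem_binChildren_of_unParents_eq_zero (Finset.mem_filter.1 hψ).1 (Finset.mem_filter.1 hψ).2
  have hunion : φ.special.card ≤ φ.binChildren.card + (φ.subF.filter fun χ => ¬ χ.isUn).card +
      (φ.subF.filter fun χ => 2 ≤ unParents φ χ).card :=
    (Finset.card_union_le _ _).trans (Nat.add_le_add_right (Finset.card_union_le _ _) _)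
  have hsplit := card_filter_isUn_add φ
  have hchildren := card_binChildren_le φ
  omega

end Special

section Segment

variable [DecidableEq α]

/-- The unary operators from a formula down to the next formula in `S`. -/
def segment (S : Finset (LTL α)) : LTL α → List UnOp
  | un o φ => o :: if φ ∈ S then [] else segment S φ
  | _ => []

/-- The formula at which the segment of a formula ends. -/
def segmentEnd (S : Finset (LTL α)) : LTL α → LTL α
  | un _ φ => if φ ∈ S then φ else segmentEnd S φ
  | φ => φ

theorem chain_segment (S : Finset (LTL α)) (φ : LTL α) :
    chain (segment S φ) (segmentEnd S φ) = φ := by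
  induction φ with
  | un o φ ih =>
    rw [segment, segmentEnd]
    split_ifs
    · rfl
    · exact congrArg (un o) ih
  | _ => rfl

theorem segmentEnd_mem {φ ψ : LTL α} (h : ψ ∈ φ.subF) (hψ : ψ.isUn) :
    segmentEnd φ.special ψ ∈ φ.special := by
  induction ψ with
  | un o ψ ih =>
    have hmem : ψ ∈ φ.subF := mem_subF_of_mem_operands h (Finset.mem_singleton_self ψ)
    rw [segmentEnd]
    split_ifs with hS
    · exact hS
    · exact ih hmem (by_contra fun hun => hS (mem_special_of_not_isUn hmem hun))
  | _ => exact absurd hψ (by simp [isUn])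

theorem sizeOf_segmentEnd_le (S : Finset (LTL α)) (φ : LTL α) :
    sizeOf (segmentEnd S φ) ≤ sizeOf φ := by
  induction φ with
  | un o φ ih =>
    rw [segmentEnd, un.sizeOf_spec]
    split_ifs <;> omega
  | _ => exact le_rfl

theorem sizeOf_segmentEnd_lt (S : Finset (LTL α)) {φ : LTL α} (h : φ.isUn) :
    sizeOf (segmentEnd S φ) < sizeOf φ := by
  cases φ with
  | un o φ =>
    have := sizeOf_segmentEnd_le S φ
    rw [segmentEnd, un.sizeOf_spec]
    split_ifs <;> omega
  | _ => exact absurd h (by simp [isUn])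

theorem length_segment (S : Finset (LTL α)) (φ : LTL α) :
    (segment S φ).length =
      if φ.isUn then 1 + ∑ ψ ∈ φ.operands, if ψ ∈ S then 0 else (segment S ψ).length else 0 := by
  cases φ with
  | un o φ =>
    simp only [segment, isUn, if_true, operands, Finset.sum_singleton, List.length_cons]
    split_ifs <;> simp [Nat.add_comm]
  | _ => simp [segment, isUn]

-- The segments that begin at special sub-formulas do not overlap.
theorem sum_length_segment_le (φ : LTL α) :
    ∑ ψ ∈ φ.special, (segment φ.special ψ).length ≤ (φ.subF.filter fun χ => χ.isUn).card := by
  set ℓ : LTL α → ℕ := fun ψ => (segment φ.special ψ).length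
  have hsplit : ∑ ψ ∈ φ.special, ℓ ψ + ∑ ψ ∈ φ.subF, (if ψ ∈ φ.special then 0 else ℓ ψ) =
      ∑ ψ ∈ φ.subF, ℓ ψ := by
    rw [← Finset.sum_filter_add_sum_filter_not φ.subF (· ∈ φ.special) ℓ,
      Finset.filter_mem_eq_inter, Finset.inter_eq_right.2 (special_subset φ), Finset.sum_filter]
    simp only [ite_not]
  have hsteps : ∑ ψ ∈ φ.subF, ℓ ψ = (φ.subF.filter fun χ => χ.isUn).card +
      ∑ ψ ∈ φ.subF, unParents φ ψ * if ψ ∈ φ.special then 0 else ℓ ψ := by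
    rw [sum_unParents_mul, Finset.card_eq_sum_ones, ← Finset.sum_add_distrib, Finset.sum_filter]
    exact Finset.sum_congr rfl fun χ _ => length_segment _ χ
  have hunique : ∑ ψ ∈ φ.subF, unParents φ ψ * (if ψ ∈ φ.special then 0 else ℓ ψ) ≤
      ∑ ψ ∈ φ.subF, if ψ ∈ φ.special then 0 else ℓ ψ := by
    refine Finset.sum_le_sum fun ψ hψ => ?_
    split_ifs with h
    · exact le_rfl
    · exact mul_le_of_le_one_left (Nat.zero_le _) (unParents_le_one_of_notMem_special hψ h)
  change ∑ ψ ∈ φ.special, ℓ ψ ≤ _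
  omega

theorem sum_max_one_length_segment_le (φ : LTL α) :
    ∑ ψ ∈ φ.special, max 1 (segment φ.special ψ).length ≤ φ.size := by
  have hpointwise : ∀ ψ : LTL α, max 1 (segment φ.special ψ).length ≤
      (segment φ.special ψ).length + if ¬ ψ.isUn then 1 else 0 := by
    intro ψ
    cases ψ <;> simp [segment, isUn]
  have hnonunary : (φ.special.filter fun ψ => ¬ ψ.isUn).card ≤
      (φ.subF.filter fun ψ => ¬ ψ.isUn).card :=
    Finset.card_le_card (Finset.filter_subset_filter _ (special_subset φ))
  calc ∑ ψ ∈ φ.special, max 1 (segment φ.special ψ).length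
      ≤ ∑ ψ ∈ φ.special, (segment φ.special ψ).length +
          (φ.special.filter fun ψ => ¬ ψ.isUn).card := by
        rw [Finset.card_filter, ← Finset.sum_add_distrib]
        exact Finset.sum_le_sum fun ψ _ => hpointwise ψ
    _ ≤ φ.size := by
        rw [← card_filter_isUn_add]
        exact Nat.add_le_add (sum_length_segment_le φ) hnonunary

end Segment

end LTL

/-! ### Formulas as circuits -/

instance : Fintype UnOp where
  elems := {.not, .X, .F, .G}
  complete := by intro o; cases o <;> decide

instance : Fintype BinLogOp where
  elems := {.or, .and, .imp, .revImp, .iff, .nor, .nand, .nimp, .nrevImp, .niff}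
  complete := by intro o; cases o <;> decide

namespace LTL

variable {α : Type} {Ut : Set UnOp} {Bl : Set BinLogOp}

/-- Semantic equivalence of formulas. -/
def Equivalent (φ ψ : LTL α) : Prop := ∀ w, Sat w φ ↔ Sat w ψ

theorem Equivalent.symm {φ ψ : LTL α} (h : Equivalent φ ψ) : Equivalent ψ φ := fun w => (h w).symm

theorem Equivalent.chain {φ ψ : LTL α} (h : Equivalent φ ψ) (c : List UnOp) :
    Equivalent (chain c φ) (chain c ψ) := by
  intro w
  rw [← suffix_zero w, sat_chain, sat_chain]
  simp only [h _]

theorem nonempty_of_formula (φ : LTL α) : Nonempty α := by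
  induction φ with
  | atom p => exact ⟨p⟩
  | un _ _ ih | binTemp _ _ _ ih | binLog _ _ _ ih => exact ih

theorem usesOnly_chain {Bt : Set BinTempOp} {c : List UnOp} {φ : LTL α} :
    (chain c φ).UsesOnly Ut Bt Bl ↔ (∀ o ∈ c, o ∈ Ut) ∧ φ.UsesOnly Ut Bt Bl := by
  induction c with
  | nil => simp [chain]
  | cons o c ih =>
    change o ∈ Ut ∧ (chain c φ).UsesOnly Ut Bt Bl ↔ _
    rw [ih, List.forall_mem_cons, and_assoc]

/-- The sub-formulas of a chain above its base. -/
def chainSet [DecidableEq α] (φ : LTL α) : List UnOp → Finset (LTL α)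
  | [] => ∅
  | o :: c => insert (chain (o :: c) φ) (chainSet φ c)

variable [DecidableEq α]

theorem subF_chain (c : List UnOp) (φ : LTL α) : (chain c φ).subF = chainSet φ c ∪ φ.subF := by
  induction c with
  | nil => exact (Finset.empty_union _).symm
  | cons o c ih =>
    change insert _ (chain c φ).subF = _
    rw [ih, chainSet, Finset.insert_union]
    rfl

theorem card_chainSet_le (c : List UnOp) (φ : LTL α) : (chainSet φ c).card ≤ c.length := by
  induction c with
  | nil => exact le_rfl
  | cons o c ih => exact (Finset.card_insert_le _ _).trans (Nat.succ_le_succ ih)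

theorem isBin_of_mem_chainSet {c : List UnOp} {φ ψ : LTL α} (h : ψ ∈ chainSet φ c) :
    ψ.isBin = false := by
  induction c with
  | nil => simp [chainSet] at h
  | cons o c ih =>
    rcases Finset.mem_insert.1 h with rfl | h
    · rfl
    · exact ih h

end LTL

/-- A gate of a circuit with access to the results of `n` earlier gates: a proposition, a chain of
unary operators applied to an earlier result, or a binary operator applied to two of them. The
proposition, and a power of `X` on top of the chain, are parameters that are supplied separately,
which leaves only finitely many gates. -/
inductive Gate (n : ℕ)
  | leaf
  | chain (c : {c : List UnOp // c.length ≤ 9}) (j : Fin n)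
  | bin (o : BinLogOp) (j k : Fin n)

namespace Gate

variable {n : ℕ} {α : Type} {Ut : Set UnOp} {Bl : Set BinLogOp}

instance : Finite (Gate n) := by
  have : Finite {c : List UnOp // c.length ≤ 9} := (List.finite_length_le UnOp 9).to_subtype
  refine Finite.of_surjective
    (α := Unit ⊕ ({c : List UnOp // c.length ≤ 9} × Fin n) ⊕ (BinLogOp × Fin n × Fin n))
    (fun
      | .inl _ => leaf
      | .inr (.inl (c, j)) => chain c j
      | .inr (.inr (o, j, k)) => bin o j k) fun g => ?_
  cases g with
  | leaf => exact ⟨.inl (), rfl⟩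
  | chain c j => exact ⟨.inr (.inl (c, j)), rfl⟩
  | bin o j k => exact ⟨.inr (.inr (o, j, k)), rfl⟩

/-- The formula computed by a gate from the results `v` of the earlier gates, with parameters `p`
for the proposition and `k` for the power of `X`. -/
def build (p : α) (k : ℕ) (v : Fin n → LTL α) : Gate n → LTL α
  | leaf => .atom p
  | chain c j => LTL.chain (List.replicate k .X ++ c.1) (v j)
  | bin o j l => .binLog o (v j) (v l)

/-- The gate uses only operators from the given sets. -/
def UsesOnly (Ut : Set UnOp) (Bl : Set BinLogOp) : Gate n → Prop
  | leaf => True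
  | chain c _ => ∀ o ∈ c.1, o ∈ Ut
  | bin o _ _ => o ∈ Bl

/-- Whether the gate is a binary operator. -/
def isBin : Gate n → Bool
  | bin _ _ _ => true
  | _ => false

/-- The number of operators and propositions of a gate, without the power of `X`. -/
def weight : Gate n → ℕ
  | chain c _ => c.1.length
  | _ => 1

theorem usesOnly_build {g : Gate n} (hg : g.UsesOnly Ut Bl) {k : ℕ} (hk : k ≠ 0 → .X ∈ Ut)
    {v : Fin n → LTL α} (hv : ∀ j, (v j).UsesOnly Ut ∅ Bl) (p : α) :
    (g.build p k v).UsesOnly Ut ∅ Bl := by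
  cases g with
  | leaf => trivial
  | chain c j =>
    refine LTL.usesOnly_chain.2 ⟨fun o ho => ?_, hv j⟩
    rcases List.mem_append.1 ho with ho | ho
    · obtain ⟨hk0, rfl⟩ := List.mem_replicate.1 ho
      exact hk hk0
    · exact hg o ho
  | bin o j l => exact ⟨hg, hv j, hv l⟩

section Size

variable [DecidableEq α]

/-- The sub-formulas of the result of a gate that do not stem from earlier results. -/
def own (p : α) (k : ℕ) (v : Fin n → LTL α) : Gate n → Finset (LTL α)
  | leaf => {.atom p}
  | chain c j => LTL.chainSet (v j) (List.replicate k .X ++ c.1)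
  | bin o j l => {.binLog o (v j) (v l)}

variable (p : α) (k : ℕ) (v : Fin n → LTL α) (g : Gate n)

theorem subF_build_subset {T : Finset (LTL α)} (hown : g.own p k v ⊆ T)
    (hv : ∀ j, (v j).subF ⊆ T) : (g.build p k v).subF ⊆ T := by
  cases g with
  | leaf => exact hown
  | chain c j =>
    rw [build, LTL.subF_chain]
    exact Finset.union_subset hown (hv j)
  | bin o j l =>
    exact Finset.insert_subset (Finset.singleton_subset_iff.1 hown)
      (Finset.union_subset (hv j) (hv l))

theorem card_own_le : (g.own p k v).card ≤ g.weight + k := by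
  cases g with
  | leaf | bin _ _ _ => simp [own, weight]
  | chain c j =>
    refine (LTL.card_chainSet_le _ _).trans_eq ?_
    rw [List.length_append, List.length_replicate, Nat.add_comm]
    rfl

theorem card_filter_isBin_own_le :
    ((g.own p k v).filter fun ψ => ψ.isBin).card ≤ if g.isBin then 1 else 0 := by
  cases g with
  | leaf => exact (congrArg Finset.card (Finset.filter_singleton _ _)).le
  | chain c j =>
    refine (Finset.card_eq_zero.2 (Finset.filter_eq_empty_iff.2 fun ψ hψ => ?_)).le
    rw [LTL.isBin_of_mem_chainSet hψ]
    exact Bool.false_ne_true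
  | bin o j l => exact Finset.card_filter_le _ _

end Size

variable [DecidableEq α] {φ ψ : LTL α}

/-- `g`, with the parameters `p` and `k`, computes a formula equivalent to `ψ` from earlier results
equivalent to `v`, at no greater cost than the segment of `ψ` between members of `S`. -/
structure Computes (Ut : Set UnOp) (Bl : Set BinLogOp) (S : Finset (LTL α)) (v : Fin n → LTL α)
    (ψ : LTL α) (g : Gate n) (p : α) (k : ℕ) : Prop where
  usesOnly : g.UsesOnly Ut Bl
  isBin : g.isBin → ψ.isBin
  power : k ≠ 0 → .X ∈ Ut
  weight : g.weight + k ≤ max 1 (ψ.segment S).length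
  equivalent : ∀ v' : Fin n → LTL α, (∀ j, (v' j).Equivalent (v j)) →
    (g.build p k v').Equivalent ψ

theorem exists_computes_of_isUn (hφ : φ.UsesOnly Ut ∅ Bl) (hψ : ψ ∈ φ.special) (hun : ψ.isUn)
    {v : Fin n → LTL α} (hv : ∀ χ ∈ φ.special, sizeOf χ < sizeOf ψ → ∃ j, v j = χ) :
    ∃ g p k, Computes Ut Bl φ.special v ψ g p k := by
  have hmem := LTL.special_subset φ hψ
  obtain ⟨j, hj⟩ := hv _ (LTL.segmentEnd_mem hmem hun) (LTL.sizeOf_segmentEnd_lt _ hun)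
  obtain ⟨p⟩ := LTL.nonempty_of_formula φ
  obtain ⟨c, hshort, hlen, hsub, hsat⟩ := LTL.exists_short_chain (ψ.segment φ.special)
  have hseg : ∀ o ∈ ψ.segment φ.special, o ∈ Ut := by
    have huses := hφ.of_mem_subF hmem
    rw [← LTL.chain_segment φ.special ψ] at huses
    exact (LTL.usesOnly_chain.1 huses).1
  refine ⟨chain ⟨c, hshort⟩ j, p, (ψ.segment φ.special).count .X,
    fun o ho => hseg o (hsub ho), fun h => absurd h (by simp [isBin]),
    fun h => hseg _ (List.count_pos_iff.1 (Nat.pos_of_ne_zero h)),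
    hlen.trans (le_max_right _ _), fun v' hv' w => ?_⟩
  rw [build, (hv' j).chain _ w, hj, ← hsat, LTL.chain_segment]

theorem exists_computes (hφ : φ.UsesOnly Ut ∅ Bl) (hψ : ψ ∈ φ.special) {v : Fin n → LTL α}
    (hv : ∀ χ ∈ φ.special, sizeOf χ < sizeOf ψ → ∃ j, v j = χ) :
    ∃ g p k, Computes Ut Bl φ.special v ψ g p k := by
  have hmem := LTL.special_subset φ hψ
  cases hcase : ψ with
  | atom p =>
    exact ⟨leaf, p, 0, trivial, fun h => absurd h (by simp [isBin]), fun h => absurd rfl h,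
      le_max_left _ _, fun _ _ _ => Iff.rfl⟩
  | un o χ => exact hcase ▸ exists_computes_of_isUn hφ hψ (hcase ▸ rfl) hv
  | binTemp o χ ξ =>
    rw [hcase] at hmem
    exact absurd (hφ.of_mem_subF hmem).1 (Set.notMem_empty o)
  | binLog o χ ξ =>
    subst hcase
    have hoperand : ∀ χ' ∈ (LTL.binLog o χ ξ).operands, ∃ j, v j = χ' := fun χ' h =>
      hv χ' (LTL.mem_special_of_mem_operands hmem rfl h) (LTL.sizeOf_lt_of_mem_operands h)
    obtain ⟨j, rfl⟩ := hoperand χ (Finset.mem_insert_self _ _)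
    obtain ⟨l, rfl⟩ := hoperand ξ (Finset.mem_insert_of_mem (Finset.mem_singleton_self _))
    obtain ⟨p⟩ := LTL.nonempty_of_formula φ
    refine ⟨bin o j l, p, 0, (hφ.of_mem_subF hmem).1, fun _ => rfl, fun h => absurd rfl h,
      le_max_left _ _, fun v' hv' w => ?_⟩
    simp only [build, LTL.Sat, hv' j w, hv' l w]

end Gate

theorem exists_equiv_fin_card_monotone {β : Type*} (s : Finset β) (f : β → ℕ) :
    ∃ e : Fin s.card ≃ s, Monotone fun i => f (e i) :=
  ⟨(Tuple.sort fun i => f (s.equivFin.symm i)).trans s.equivFin.symm,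
    Tuple.monotone_sort fun i => f (s.equivFin.symm i)⟩

/-- A sequence of `K` gates, each with access to the results of the gates before it. -/
def Circuit (K : ℕ) : Type := (i : Fin K) → Gate i

namespace Circuit

variable {K : ℕ} {α : Type} {Ut : Set UnOp} {Bl : Set BinLogOp}

instance : Finite (Circuit K) := inferInstanceAs (Finite ((i : Fin K) → Gate i))

/-- The formula computed at gate `i`, where `θ` and `κ` are the parameters of the gates. -/
def inst (σ : Circuit K) (θ : Fin K → α) (κ : Fin K → ℕ) (i : Fin K) : LTL α :=
  (σ i).build (θ i) (κ i) fun j => σ.inst θ κ (j.castLE i.is_lt.le)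
termination_by i.val
decreasing_by exact j.is_lt

/-- The circuit uses only operators from the given sets. -/
def UsesOnly (Ut : Set UnOp) (Bl : Set BinLogOp) (σ : Circuit K) : Prop :=
  ∀ i, (σ i).UsesOnly Ut Bl

/-- The number of gates with a binary operator. -/
def numBin (σ : Circuit K) : ℕ := ∑ i, if (σ i).isBin then 1 else 0

/-- The size of a circuit when the powers of `X` are given by `κ`. -/
def size (σ : Circuit K) (κ : Fin K → ℕ) : ℕ := ∑ i, ((σ i).weight + κ i)

theorem usesOnly_inst {σ : Circuit K} (hσ : σ.UsesOnly Ut Bl) {κ : Fin K → ℕ}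
    (hκ : ∀ i, κ i ≠ 0 → .X ∈ Ut) (θ : Fin K → α) (i : Fin K) :
    (σ.inst θ κ i).UsesOnly Ut ∅ Bl := by
  induction i using WellFoundedLT.induction with
  | _ i ih =>
    rw [inst]
    exact Gate.usesOnly_build (hσ i) (hκ i) (fun j => ih _ j.is_lt) _

section Size

variable [DecidableEq α] (σ : Circuit K) (θ : Fin K → α) (κ : Fin K → ℕ)

/-- The sub-formulas that gate `i` adds to those of the earlier gates. -/
def own (i : Fin K) : Finset (LTL α) :=
  (σ i).own (θ i) (κ i) fun j => σ.inst θ κ (j.castLE i.is_lt.le)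

theorem subF_inst_subset (i : Fin K) :
    (σ.inst θ κ i).subF ⊆ Finset.univ.biUnion (σ.own θ κ) := by
  induction i using WellFoundedLT.induction with
  | _ i ih =>
    rw [inst]
    exact Gate.subF_build_subset _ _ _ _
      (Finset.subset_biUnion_of_mem (σ.own θ κ) (Finset.mem_univ i)) fun j => ih _ j.is_lt

theorem size_inst_le (i : Fin K) : (σ.inst θ κ i).size ≤ σ.size κ :=
  (Finset.card_le_card (σ.subF_inst_subset θ κ i)).trans
    (Finset.card_biUnion_le.trans (Finset.sum_le_sum fun _ _ => Gate.card_own_le _ _ _ _))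

theorem numBin_inst_le (i : Fin K) : (σ.inst θ κ i).numBin ≤ σ.numBin := by
  refine (Finset.card_le_card (Finset.filter_subset_filter _ (σ.subF_inst_subset θ κ i))).trans ?_
  rw [Finset.filter_biUnion]
  exact Finset.card_biUnion_le.trans
    (Finset.sum_le_sum fun _ _ => Gate.card_filter_isBin_own_le _ _ _ _)

end Size

-- The gates are the special sub-formulas, sorted by length so that operands come first.
theorem exists_inst_equivalent [DecidableEq α] {φ : LTL α} (hφ : φ.UsesOnly Ut ∅ Bl) :
    ∃ K ≤ 2 * (2 * φ.numBin + 1), ∃ (σ : Circuit K) (θ : Fin K → α) (κ : Fin K → ℕ) (i : Fin K),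
      σ.UsesOnly Ut Bl ∧ σ.numBin ≤ φ.numBin ∧ (∀ i, κ i ≠ 0 → .X ∈ Ut) ∧ σ.size κ ≤ φ.size ∧
      (σ.inst θ κ i).Equivalent φ := by
  obtain ⟨e, he⟩ := exists_equiv_fin_card_monotone φ.special sizeOf
  have hearlier : ∀ i, ∀ χ ∈ φ.special, sizeOf χ < sizeOf (e i : LTL α) →
      ∃ j : Fin i, (e (j.castLE i.is_lt.le) : LTL α) = χ := by
    intro i χ hχ hlt
    have hj : e.symm ⟨χ, hχ⟩ < i := he.reflect_lt (by simpa using hlt)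
    exact ⟨⟨e.symm ⟨χ, hχ⟩, hj⟩, congrArg Subtype.val (e.apply_symm_apply ⟨χ, hχ⟩)⟩
  obtain ⟨σ, θ, κ, hσ⟩ : ∃ (σ : Circuit φ.special.card) (θ : Fin _ → α) (κ : Fin _ → ℕ),
      ∀ i, Gate.Computes Ut Bl φ.special _ (e i) (σ i) (θ i) (κ i) := by
    choose σ θ κ hσ using fun i => Gate.exists_computes hφ (e i).2 (hearlier i)
    exact ⟨σ, θ, κ, hσ⟩
  have hequiv : ∀ i, (σ.inst θ κ i).Equivalent (e i) := by
    intro i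
    induction i using WellFoundedLT.induction with
    | _ i ih =>
      rw [inst]
      exact (hσ i).equivalent _ fun j => ih _ j.is_lt
  refine ⟨_, LTL.card_special_le φ, σ, θ, κ, e.symm ⟨φ, LTL.self_mem_special φ⟩,
    fun i => (hσ i).usesOnly, ?_, fun i => (hσ i).power, ?_, by simpa using hequiv (e.symm _)⟩
  · calc σ.numBin ≤ ∑ i, if (e i : LTL α).isBin then 1 else 0 :=
          Finset.sum_le_sum fun i _ => by
            have := (hσ i).isBin
            split_ifs <;> simp_all
      _ = ∑ ψ ∈ φ.special, if ψ.isBin then 1 else 0 := by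
          rw [Equiv.sum_comp e fun ψ => if (ψ : LTL α).isBin then 1 else 0,
            Finset.sum_coe_sort φ.special fun ψ => if ψ.isBin then 1 else 0]
      _ ≤ φ.numBin := by
          rw [← Finset.card_filter]
          exact Finset.card_le_card (Finset.filter_subset_filter _ (LTL.special_subset φ))
  · calc σ.size κ ≤ ∑ i, max 1 (LTL.segment φ.special (e i)).length :=
          Finset.sum_le_sum fun i _ => (hσ i).weight
      _ = ∑ ψ ∈ φ.special, max 1 (LTL.segment φ.special ψ).length := by
          rw [Equiv.sum_comp e fun ψ => max 1 (LTL.segment φ.special ψ).length,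
            Finset.sum_coe_sort φ.special fun ψ => max 1 (LTL.segment φ.special ψ).length]
      _ ≤ φ.size := LTL.sum_max_one_length_segment_le φ

theorem exists_formula_iff [DecidableEq α] {P : LTL α → Prop}
    (hP : ∀ {φ ψ}, φ.Equivalent ψ → P φ → P ψ) {n B : ℕ} :
    (∃ φ : LTL α, φ.UsesOnly Ut ∅ Bl ∧ φ.size ≤ B ∧ φ.numBin ≤ n ∧ P φ) ↔
      ∃ K ≤ 2 * (2 * n + 1), ∃ (σ : Circuit K) (i : Fin K), σ.UsesOnly Ut Bl ∧ σ.numBin ≤ n ∧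
        ∃ (θ : Fin K → α) (κ : Fin K → ℕ),
          (∀ i, κ i ≠ 0 → .X ∈ Ut) ∧ σ.size κ ≤ B ∧ P (σ.inst θ κ i) := by
  constructor
  · rintro ⟨φ, hφ, hB, hn, h⟩
    obtain ⟨K, hK, σ, θ, κ, i, huses, hbin, hX, hsize, hequiv⟩ := exists_inst_equivalent hφ
    exact ⟨K, hK.trans (by omega), σ, i, huses, hbin.trans hn, θ, κ, hX, hsize.trans hB,
      hP hequiv.symm h⟩
  · rintro ⟨K, -, σ, i, huses, hn, θ, κ, hX, hB, h⟩
    exact ⟨σ.inst θ κ i, usesOnly_inst huses hX θ i, (σ.size_inst_le θ κ i).trans hB,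
      (σ.numBin_inst_le θ κ i).trans hn, h⟩

end Circuit

/-! ### Recognising encodings -/

section Encoding

section Prefix

variable {A : Type*} {x l l' : List A} {i : ℕ}

theorem isPrefix_drop_iff :
    l <+: x.drop i ↔ ∀ t (ht : t < l.length), x[i + t]? = some l[t] := by
  simp only [List.prefix_iff_getElem?, List.getElem?_drop]

theorem cons_isPrefix_drop_iff {a : A} :
    a :: l <+: x.drop i ↔ x[i]? = some a ∧ l <+: x.drop (i + 1) := by
  simp only [isPrefix_drop_iff, List.length_cons, Nat.forall_lt_succ_left', List.getElem_cons_zero,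
    List.getElem_cons_succ, Nat.add_zero, Nat.add_right_comm, Nat.add_assoc]

theorem append_isPrefix_drop_iff :
    l ++ l' <+: x.drop i ↔ l <+: x.drop i ∧ l' <+: x.drop (i + l.length) := by
  induction l generalizing i with
  | nil => simp
  | cons a l ih =>
    rw [List.cons_append, cons_isPrefix_drop_iff, ih, cons_isPrefix_drop_iff, and_assoc,
      List.length_cons, Nat.add_right_comm, Nat.add_assoc i]

theorem replicate_isPrefix_drop_iff {n : ℕ} {a : A} :
    List.replicate n a <+: x.drop i ↔ ∀ t < n, x[i + t]? = some a := by
  simp [isPrefix_drop_iff]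

theorem drop_eq_append (h : l <+: x.drop i) : x.drop i = l ++ x.drop (i + l.length) := by
  rw [← List.drop_drop]
  exact List.prefix_iff_eq_append.1 h |>.symm

end Prefix

variable {x : List LearnSym} {m i a b e : ℕ} {k : LearnSym}

/-- The symbols that begin the encoding of a word. -/
def IsMark (k : LearnSym) : Prop := k = .pos ∨ k = .neg

/-- At position `e` the input ends or a mark is written. -/
def EndAt (x : List LearnSym) (e : ℕ) : Prop :=
  x.length ≤ e ∨ x[e]? = some .pos ∨ x[e]? = some .neg

theorem IsMark.endAt (hk : IsMark k) (h : x[e]? = some k) : EndAt x e := by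
  rcases hk with rfl | rfl
  · exact .inr (.inl h)
  · exact .inr (.inr h)

/-- The encoding of a letter over `m` propositions is written at position `i`. -/
def LetterAt (x : List LearnSym) (m i : ℕ) : Prop :=
  x[i]? = some .letter ∧ ∀ t < m, x[i + 1 + t]? = some .zero ∨ x[i + 1 + t]? = some .one

/-- The letter written at position `i`. -/
def letterAt (x : List LearnSym) (m i : ℕ) : Finset (Fin m) :=
  Finset.univ.filter fun p => x[i + 1 + p]? = some .one

/-- The encodings of `a` letters are written from position `i` on. -/
def LettersAt (x : List LearnSym) (m i a : ℕ) : Prop := ∀ t < a, LetterAt x m (i + t * (m + 1))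

/-- The `a` letters written from position `i` on. -/
def lettersAt (x : List LearnSym) (m i a : ℕ) : List (Finset (Fin m)) :=
  List.ofFn fun t : Fin a => letterAt x m (i + t * (m + 1))

/-- After position `i`, a word with a prefix of length `a` and a period of length `b` is written. -/
def WordAt (x : List LearnSym) (m i a b : ℕ) : Prop :=
  LettersAt x m (i + 1) a ∧ x[i + 1 + a * (m + 1)]? = some .loop ∧
    LettersAt x m (i + 1 + a * (m + 1) + 1) b ∧ EndAt x (i + 1 + a * (m + 1) + 1 + b * (m + 1))

/-- The word written after position `i`. -/
def wordAt (x : List LearnSym) (m i a b : ℕ) (hb : 0 < b) : UPWord (Fin m) where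
  pre := lettersAt x m (i + 1) a
  per := lettersAt x m (i + 1 + a * (m + 1) + 1) b
  per_ne := by
    rw [← List.length_pos_iff, lettersAt, List.length_ofFn]
    exact hb

/-- The encoding of `w` with mark `k` is written at position `i`, and a mark or the end of the input
follows. -/
def Occurs {m : ℕ} (x : List LearnSym) (i : ℕ) (k : LearnSym) (w : UPWord (Fin m)) : Prop :=
  encodeWord k w <+: x.drop i ∧ EndAt x (i + (encodeWord k w).length)

theorem length_flatMap_encodeLetter (l : List (Finset (Fin m))) :
    (l.flatMap encodeLetter).length = l.length * (m + 1) := by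
  simp [List.length_flatMap, encodeLetter]

theorem encodeLetter_isPrefix_drop_iff {s : Finset (Fin m)} :
    encodeLetter s <+: x.drop i ↔ LetterAt x m i ∧ s = letterAt x m i := by
  rw [encodeLetter, cons_isPrefix_drop_iff, isPrefix_drop_iff, LetterAt, and_assoc]
  refine and_congr_right fun _ => ?_
  simp only [List.length_ofFn, List.getElem_ofFn, Finset.ext_iff, letterAt, Finset.mem_filter,
    Finset.mem_univ, true_and, Fin.forall_iff, ← forall₂_and]
  refine forall₂_congr fun t ht => ?_
  split_ifs with hs
  · simp only [hs, true_iff, iff_and_self]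
    exact Or.inr
  · simp only [hs, false_iff]
    exact ⟨fun h => ⟨.inl h, by simp [h]⟩, fun h => h.1.resolve_right h.2⟩

theorem flatMap_encodeLetter_isPrefix_drop_iff {l : List (Finset (Fin m))} :
    l.flatMap encodeLetter <+: x.drop i ↔
      LettersAt x m i l.length ∧ l = lettersAt x m i l.length := by
  induction l generalizing i with
  | nil => simp [LettersAt, lettersAt]
  | cons s l ih =>
    have hlength : (encodeLetter s).length = m + 1 := by simp [encodeLetter]
    have hshift : ∀ t, i + (t + 1) * (m + 1) = i + (m + 1) + t * (m + 1) := fun t => by ring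
    rw [List.flatMap_cons, append_isPrefix_drop_iff, encodeLetter_isPrefix_drop_iff, hlength, ih]
    simp only [LettersAt, lettersAt, List.length_cons, Nat.forall_lt_succ_left, List.ofFn_succ,
      List.cons.injEq, Fin.val_zero, Fin.val_succ, hshift, Nat.zero_mul, Nat.add_zero]
    tauto

theorem encodeWord_isPrefix_drop_iff {w : UPWord (Fin m)} :
    encodeWord k w <+: x.drop i ↔ x[i]? = some k ∧
      w.pre.flatMap encodeLetter <+: x.drop (i + 1) ∧
      x[i + 1 + w.pre.length * (m + 1)]? = some .loop ∧
      w.per.flatMap encodeLetter <+: x.drop (i + 1 + w.pre.length * (m + 1) + 1) := by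
  rw [encodeWord, cons_isPrefix_drop_iff, append_isPrefix_drop_iff, cons_isPrefix_drop_iff,
    length_flatMap_encodeLetter]

theorem length_encodeWord (w : UPWord (Fin m)) :
    i + (encodeWord k w).length =
      i + 1 + w.pre.length * (m + 1) + 1 + w.per.length * (m + 1) := by
  simp only [encodeWord, List.length_cons, List.length_append, length_flatMap_encodeLetter]
  ring

theorem exists_occurs_iff {R : UPWord (Fin m) → Prop} :
    (∃ w, Occurs x i k w ∧ R w) ↔
      x[i]? = some k ∧ ∃ a b, ∃ hb : 0 < b, WordAt x m i a b ∧ R (wordAt x m i a b hb) := by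
  simp only [Occurs, encodeWord_isPrefix_drop_iff, length_encodeWord,
    flatMap_encodeLetter_isPrefix_drop_iff, WordAt]
  constructor
  · rintro ⟨⟨pre, per, hne⟩, ⟨⟨hk, ⟨hpre, hpre'⟩, hloop, hper, hper'⟩, hend⟩, hR⟩
    refine ⟨hk, pre.length, per.length, List.length_pos_iff.2 hne, ⟨hpre, hloop, hper, hend⟩, ?_⟩
    simpa only [wordAt, ← hpre', ← hper'] using hR
  · rintro ⟨hk, a, b, hb, ⟨hpre, hloop, hper, hend⟩, hR⟩
    refine ⟨wordAt x m i a b hb, ?_, hR⟩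
    simpa [wordAt, lettersAt] using ⟨⟨hk, hpre, hloop, hper⟩, hend⟩

theorem IsMark.notMem_tail_encodeWord {k' : LearnSym} {w : UPWord (Fin m)} (hk : IsMark k) :
    k ∉ (encodeWord k' w).tail := by
  have hletter : ∀ s : Finset (Fin m), k ∉ encodeLetter s := by
    intro s hs
    simp only [encodeLetter, List.mem_cons, List.mem_ofFn] at hs
    rcases hs with rfl | ⟨p, rfl⟩
    · simp [IsMark] at hk
    · split_ifs at hk <;> simp [IsMark] at hk
  have hloop : k ≠ .loop := by
    rintro rfl
    simp [IsMark] at hk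
  simp [encodeWord, hletter, hloop]

theorem IsMark.eq_of_mem_encodeWord {k' : LearnSym} {w : UPWord (Fin m)} (hk : IsMark k)
    (h : k ∈ encodeWord k' w) : k = k' :=
  (List.mem_cons.1 h).resolve_right (hk.notMem_tail_encodeWord (k' := k') (w := w))

/-- From position `e` on, the input consists of encodings of words, and those with mark `k` satisfy
`R k`. -/
def Parsed {m : ℕ} (R : LearnSym → UPWord (Fin m) → Prop) (x : List LearnSym) (e : ℕ) : Prop :=
  EndAt x e ∧ ∀ i ≥ e, ∀ k, IsMark k → x[i]? = some k → ∃ w, Occurs x i k w ∧ R k w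

namespace Parsed

variable {R : LearnSym → UPWord (Fin m) → Prop}

theorem of_length_le (h : x.length ≤ e) : Parsed R x e :=
  ⟨.inl h, fun i hi k _ hik => by simp [List.getElem?_eq_none (h.trans hi)] at hik⟩

theorem of_encodeWord {w : UPWord (Fin m)} (hk : IsMark k) (hw : encodeWord k w <+: x.drop e)
    (hR : R k w) (h : Parsed R x (e + (encodeWord k w).length)) : Parsed R x e := by
  have hmark := (encodeWord_isPrefix_drop_iff.1 hw).1
  refine ⟨hk.endAt hmark, fun i hi k' hk' hik => ?_⟩
  rcases hi.eq_or_lt with rfl | hi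
  · obtain rfl : k = k' := Option.some.inj (hmark.symm.trans hik)
    exact ⟨w, ⟨hw, h.1⟩, hR⟩
  rcases le_or_gt (e + (encodeWord k w).length) i with hi' | hi'
  · exact h.2 i hi' k' hk' hik
  · obtain ⟨t, rfl⟩ := Nat.exists_eq_add_of_lt hi
    have ht : t + 1 < (encodeWord k w).length := by omega
    obtain rfl : (encodeWord k w)[t + 1] = k' :=
      Option.some.inj ((isPrefix_drop_iff.1 hw _ ht).symm.trans hik)
    have hmem : (encodeWord k w)[t + 1] ∈ (encodeWord k w).tail :=
      List.getElem_mem (l := (encodeWord k w).tail) (n := t) (Nat.lt_of_succ_lt_succ ht)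
    exact absurd hmem hk'.notMem_tail_encodeWord

theorem of_flatMap_encodeWord {L : List (UPWord (Fin m))} (hk : IsMark k)
    (hL : L.flatMap (encodeWord k) <+: x.drop e) (hR : ∀ w ∈ L, R k w)
    (h : Parsed R x (e + (L.flatMap (encodeWord k)).length)) : Parsed R x e := by
  induction L generalizing e with
  | nil => exact h
  | cons w L ih =>
    rw [List.flatMap_cons, append_isPrefix_drop_iff] at hL
    rw [List.forall_mem_cons] at hR
    rw [List.flatMap_cons, List.length_append, ← Nat.add_assoc] at h
    exact of_encodeWord hk hL.1 hR.1 (ih hL.2 hR.2 h)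

theorem exists_words (h : Parsed R x e) (hx : x.Pairwise fun s t => s = .neg → t ≠ .pos) :
    ∃ P N : List (UPWord (Fin m)),
      x.drop e = P.flatMap (encodeWord .pos) ++ N.flatMap (encodeWord .neg) ∧
      (∀ w ∈ P, R .pos w) ∧ ∀ w ∈ N, R .neg w := by
  induction hd : x.length - e using Nat.strong_induction_on generalizing e with
  | _ d ih =>
    rcases le_or_gt x.length e with hlen | hlen
    · exact ⟨[], [], by simpa using hlen, by simp, by simp⟩
    obtain ⟨k, hk, hek⟩ : ∃ k, IsMark k ∧ x[e]? = some k := by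
      rcases h.1 with h | h | h
      · exact absurd h (not_le.2 hlen)
      · exact ⟨_, .inl rfl, h⟩
      · exact ⟨_, .inr rfl, h⟩
    obtain ⟨w, ⟨hw, hend⟩, hR⟩ := h.2 e le_rfl k hk hek
    have hdrop := drop_eq_append hw
    have hpos : 0 < (encodeWord k w).length := Nat.succ_pos _
    obtain ⟨P, N, hPN, hP, hN⟩ := ih (x.length - (e + (encodeWord k w).length)) (by omega)
      ⟨hend, fun i hi => h.2 i ((Nat.le_add_right _ _).trans hi)⟩ rfl
    rw [hPN] at hdrop
    rcases hk with rfl | rfl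
    · exact ⟨w :: P, N, by simpa using hdrop, List.forall_mem_cons.2 ⟨hR, hP⟩, hN⟩
    · have hP' : P = [] := by
        cases P with
        | nil => rfl
        | cons w' P =>
          have := hx.drop (i := e)
          rw [hdrop] at this
          exact absurd rfl ((List.pairwise_append.1 this).2.2 _ List.mem_cons_self .pos
            (by simp [encodeWord]) rfl)
      subst hP'
      exact ⟨[], w :: N, by simpa using hdrop, by simp, List.forall_mem_cons.2 ⟨hR, hN⟩⟩

end Parsed

/-- The input begins with `m` propositions and `B` ticks, and no positive mark comes after a
negative one. -/
def Header (x : List LearnSym) (m B : ℕ) : Prop :=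
  List.replicate m .prop ++ List.replicate B .tick <+: x ∧
    x.Pairwise fun s t => s = .neg → t ≠ .pos

theorem header_encode (I : LearnInput) : Header I.encode I.numProp I.bound := by
  refine ⟨⟨I.pos.flatMap (encodeWord .pos) ++ I.neg.flatMap (encodeWord .neg), ?_⟩, ?_⟩
  · simp only [LearnInput.encode, List.append_assoc]
  rw [LearnInput.encode, List.pairwise_append]
  have hneg : ∀ s ∈ List.replicate I.numProp .prop ++ List.replicate I.bound .tick ++
      I.pos.flatMap (encodeWord .pos), s ≠ .neg := by
    rintro _ hs rfl
    simp only [List.mem_append, List.mem_replicate, List.mem_flatMap, reduceCtorEq, and_false,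
      false_or] at hs
    obtain ⟨w, -, hw⟩ := hs
    exact absurd (IsMark.eq_of_mem_encodeWord (.inr rfl) hw) (by decide)
  have hpos : ∀ s ∈ I.neg.flatMap (encodeWord .neg), s ≠ .pos := by
    rintro _ hs rfl
    obtain ⟨w, -, hw⟩ := List.mem_flatMap.1 hs
    exact absurd (IsMark.eq_of_mem_encodeWord (.inl rfl) hw) (by decide)
  exact ⟨List.pairwise_of_forall_mem_list fun s hs _ _ h => absurd h (hneg s hs),
    List.pairwise_of_forall_mem_list fun _ _ t ht _ => hpos t ht,
    fun s hs _ _ h => absurd h (hneg s hs)⟩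

theorem parsed_encode {R : LearnSym → UPWord (Fin m) → Prop} {P N : List (UPWord (Fin m))} {B : ℕ}
    (hP : ∀ w ∈ P, R .pos w) (hN : ∀ w ∈ N, R .neg w) :
    Parsed R (LearnInput.encode ⟨m, P, N, B⟩) (m + B) := by
  set x := LearnInput.encode ⟨m, P, N, B⟩ with hx
  have hprefix : LearnInput.encode ⟨m, P, N, B⟩ <+: x.drop 0 := List.prefix_rfl
  simp only [LearnInput.encode, append_isPrefix_drop_iff, List.length_append, List.length_replicate,
    Nat.zero_add] at hprefix
  refine .of_flatMap_encodeWord (.inl rfl) hprefix.1.2 hP ?_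
  refine .of_flatMap_encodeWord (.inr rfl) (by simpa only [Nat.add_assoc] using hprefix.2) hN ?_
  exact .of_length_le (by simp [hx, LearnInput.encode, Nat.add_assoc])

theorem exists_encode_eq_iff {B : ℕ} {R : LearnSym → UPWord (Fin m) → Prop} :
    (∃ P N, LearnInput.encode ⟨m, P, N, B⟩ = x ∧ (∀ w ∈ P, R .pos w) ∧ ∀ w ∈ N, R .neg w) ↔
      Header x m B ∧ Parsed R x (m + B) := by
  constructor
  · rintro ⟨P, N, rfl, hP, hN⟩
    exact ⟨header_encode _, parsed_encode hP hN⟩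
  · rintro ⟨hheader, hparsed⟩
    obtain ⟨P, N, hPN, hP, hN⟩ := hparsed.exists_words hheader.2
    refine ⟨P, N, ?_, hP, hN⟩
    have := List.prefix_iff_eq_append.1 hheader.1
    rw [List.length_append, List.length_replicate, List.length_replicate, hPN] at this
    simpa [LearnInput.encode] using this

end Encoding

/-! ### Evaluation on ultimately periodic words -/

theorem exists_add_iff_of_eventually_periodic {f : ℕ → Prop} {a b : ℕ} (hb : 0 < b)
    (hf : ∀ j ≥ a, (f (j + b) ↔ f j)) (i : ℕ) : (∃ j, f (i + j)) ↔ ∃ j < a + b, f (i + j) := by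
  refine ⟨?_, fun ⟨j, _, h⟩ => ⟨j, h⟩⟩
  rintro ⟨j, h⟩
  induction j using Nat.strong_induction_on with
  | _ j ih =>
    rcases lt_or_ge j (a + b) with hj | hj
    · exact ⟨j, hj, h⟩
    · refine ih (j - b) (by omega) ((hf _ (by omega)).1 ?_)
      rwa [Nat.add_assoc, Nat.sub_add_cancel (by omega)]

namespace UnOp

/-- The action of a unary operator on predicates of positions, where `F` and `G` look only at the
next `D` positions. -/
def semWithin (D : ℕ) : UnOp → (ℕ → Prop) → ℕ → Prop
  | .not, f, i => ¬ f i
  | .X, f, i => f (i + 1)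
  | .F, f, i => ∃ j < D, f (i + j)
  | .G, f, i => ∀ j < D, f (i + j)

theorem semWithin_eq_sem {f : ℕ → Prop} {a b : ℕ} (hb : 0 < b)
    (hf : ∀ j ≥ a, (f (j + b) ↔ f j)) (o : UnOp) :
    o.semWithin (a + b) f = o.sem f := by
  funext i
  cases o with
  | not | X => rfl
  | F => exact propext (exists_add_iff_of_eventually_periodic hb hf i).symm
  | G =>
    have := exists_add_iff_of_eventually_periodic (f := fun j => ¬ f j) hb
      (fun j hj => not_congr (hf j hj)) i
    simpa only [semWithin, sem, not_exists, not_and, not_not, eq_iff_iff] using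
      (not_congr this).symm

end UnOp

namespace UPWord

open LTL

variable {α : Type} (w : UPWord α)

theorem suffix_add_period {j : ℕ} (hj : w.pre.length ≤ j) :
    suffix w.toWord (j + w.per.length) = suffix w.toWord j := by
  funext l
  have hperiod : j + w.per.length + l - w.pre.length = j + l - w.pre.length + w.per.length := by
    omega
  simp only [suffix, toWord]
  rw [dif_neg (by omega), dif_neg (by omega)]
  simp only [hperiod, Nat.add_mod_right]

theorem foldr_semWithin_sat (c : List UnOp) (φ : LTL α) :
    c.foldr (UnOp.semWithin (w.pre.length + w.per.length))
      (fun j => Sat (suffix w.toWord j) φ) = fun j => Sat (suffix w.toWord j) (chain c φ) := by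
  induction c with
  | nil => rfl
  | cons o c ih =>
    rw [List.foldr_cons, ih, UnOp.semWithin_eq_sem (List.length_pos_of_ne_nil w.per_ne)
      fun j hj => by rw [w.suffix_add_period hj]]
    exact funext fun j => propext (sat_un _ o _ j).symm

end UPWord

theorem LTL.sat_chain_replicate_X {α : Type} (w : ℕ → Set α) (φ : LTL α) (k j : ℕ) :
    Sat (suffix w j) (chain (List.replicate k .X) φ) ↔ Sat (suffix w (j + k)) φ := by
  induction k generalizing j with
  | zero => rfl
  | succ k ih =>
    exact (sat_un w .X _ j).trans ((ih _).trans (by rw [Nat.add_assoc, Nat.add_comm 1]))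

/-- The truth of the result of a gate at a position, from the truth of the proposition and of the
earlier results at all positions; `F` and `G` look only at the next `D` positions. -/
def Gate.Holds {n : ℕ} (D : ℕ) (p : ℕ → Prop) (k : ℕ) (v : Fin n → ℕ → Prop) : Gate n → ℕ → Prop
  | leaf, j => p j
  | chain c l, j => c.1.foldr (UnOp.semWithin D) (v l) (j + k)
  | bin o l l', j => o.eval (v l j) (v l' j)

namespace Circuit

variable {K : ℕ}

/-- The truth at a position of the formula computed at gate `i`, where `p` says at which positions
the proposition of each gate is true; `F` and `G` look only at the next `D` positions. -/
def Holds (D : ℕ) (p : Fin K → ℕ → Prop) (κ : Fin K → ℕ) (σ : Circuit K) (i : Fin K) : ℕ → Prop :=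
  (σ i).Holds D (p i) (κ i) fun j => σ.Holds D p κ (j.castLE i.is_lt.le)
termination_by i.val
decreasing_by exact j.is_lt

theorem holds_iff_sat_inst {α : Type} (w : UPWord α) (σ : Circuit K) (θ : Fin K → α)
    (κ : Fin K → ℕ) (i : Fin K) (j : ℕ) :
    σ.Holds (w.pre.length + w.per.length) (fun l t => θ l ∈ w.toWord t) κ i j ↔
      LTL.Sat (LTL.suffix w.toWord j) (σ.inst θ κ i) := by
  induction i using WellFoundedLT.induction generalizing j with
  | _ i ih =>
    have hearlier : (fun l : Fin i => σ.Holds (w.pre.length + w.per.length)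
        (fun l t => θ l ∈ w.toWord t) κ (l.castLE i.is_lt.le)) = fun l t =>
          LTL.Sat (LTL.suffix w.toWord t) (σ.inst θ κ (l.castLE i.is_lt.le)) :=
      funext fun l => funext fun t => propext (ih _ l.is_lt t)
    rw [Holds, inst, hearlier]
    cases σ i with
    | leaf => rfl
    | chain c l =>
      simp only [Gate.Holds, Gate.build, w.foldr_semWithin_sat, LTL.chain_append,
        LTL.sat_chain_replicate_X]
    | bin o l l' => rfl

end Circuit

/-- The word written after position `i` of `x`, with a prefix of length `a` and a period of length
`b`, contains the proposition `p` in its letter number `j`. The numbers `q` and `r` stand for the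
quotient and the remainder of `j - a` by `b`. -/
def BitAt (x : List LearnSym) (m i a b j p : ℕ) : Prop :=
  (j < a ∧ x[i + 1 + j * (m + 1) + 1 + p]? = some .one) ∨
  ∃ q < j + 1, ∃ r < b, j = a + q * b + r ∧
    x[i + 1 + a * (m + 1) + 1 + r * (m + 1) + 1 + p]? = some .one

theorem mem_toWord_wordAt {x : List LearnSym} {m i a b : ℕ} (hb : 0 < b) (j : ℕ) (p : Fin m) :
    p ∈ (wordAt x m i a b hb).toWord j ↔ BitAt x m i a b j p := by
  simp only [UPWord.toWord, wordAt, lettersAt, List.length_ofFn, List.getElem_ofFn]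
  rw [BitAt]
  split_ifs with hj
  · have hne : ∀ q r, j ≠ a + q * b + r := fun q r => by
      rw [Nat.add_assoc]
      omega
    simp [letterAt, hj, hne]
  · simp only [letterAt, Finset.coe_filter, Finset.mem_univ, true_and, Set.mem_ofPred_eq, hj,
      false_and, false_or]
    constructor
    · intro h
      refine ⟨(j - a) / b, ?_, (j - a) % b, Nat.mod_lt _ hb, ?_, h⟩
      · exact Nat.lt_succ_of_le ((Nat.div_le_self _ _).trans (Nat.sub_le _ _))
      · have := Nat.div_add_mod' (j - a) b
        omega
    · rintro ⟨q, -, r, hr, rfl, h⟩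
      rwa [Nat.add_assoc a, Nat.add_sub_cancel_left, Nat.mul_comm q, Nat.mul_add_mod,
        Nat.mod_eq_of_lt hr]

/-! ### The learning problem in logarithmic space -/

section Learning

open Ctx

variable {A Γ : Type} [Ctx A Γ]

/-- Predicates of a context and a position that are decidable in logarithmic space in all richer
contexts in which the position is computable. -/
def LogPosPred (P : Γ → ℕ → Prop) : Prop :=
  ∀ (Γ' : Type) [Ctx A Γ'] (π : Γ' → Γ), Forgets π → ∀ j : Γ' → ℕ, LogFun j →
    LogPred fun g => P (π g) (j g)

theorem LogPred.eval (o : BinLogOp) {P Q : Γ → Prop} (hP : LogPred P) (hQ : LogPred Q) :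
    LogPred fun g => o.eval (P g) (Q g) := by
  cases o with
  | or => exact hP.or hQ
  | and => exact hP.and hQ
  | imp => exact hP.imp hQ
  | revImp => exact hQ.imp hP
  | iff => exact hP.iff hQ
  | nor => exact (hP.or hQ).not
  | nand => exact (hP.and hQ).not
  | nimp => exact (hP.imp hQ).not
  | nrevImp => exact (hQ.imp hP).not
  | niff => exact (hP.iff hQ).not

namespace LogPosPred

variable {P : Γ → ℕ → Prop} {D k : Γ → ℕ}

theorem semWithin (hD : LogFun D) (hP : LogPosPred P) (o : UnOp) :
    LogPosPred fun g => o.semWithin (D g) (P g) := by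
  intro Γ' _ π hπ j hj
  have hshift := hP (Γ' × ℕ) _ hπ.fst _ (hj.fst.add .snd)
  cases o with
  | not => exact (hP Γ' π hπ j hj).not
  | X => exact hP Γ' π hπ _ hj.succ
  | F => exact .exists_lt (P := fun g t => P (π g) (j g + t)) (hπ.logFun hD) hshift
  | G => exact .forall_lt (P := fun g t => P (π g) (j g + t)) (hπ.logFun hD) hshift

theorem gateHolds {n : ℕ} (hD : LogFun D) (hP : LogPosPred P) (hk : LogFun k)
    {v : Fin n → Γ → ℕ → Prop} (hv : ∀ l, LogPosPred (v l)) (γ : Gate n) :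
    LogPosPred fun g => γ.Holds (D g) (P g) (k g) fun l => v l g := by
  cases γ with
  | leaf => exact hP
  | chain c l =>
    have hchain : LogPosPred fun g => c.1.foldr (UnOp.semWithin (D g)) (v l g) := by
      induction c.1 with
      | nil => exact hv l
      | cons o c ih => exact ih.semWithin hD o
    exact fun Γ' _ π hπ j hj => hchain Γ' π hπ _ (hj.add (hπ.logFun hk))
  | bin o l l' => exact fun Γ' _ π hπ j hj => (hv l Γ' π hπ j hj).eval o (hv l' Γ' π hπ j hj)

theorem circuitHolds {K : ℕ} (hD : LogFun D) {p : Fin K → Γ → ℕ → Prop}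
    (hp : ∀ l, LogPosPred (p l)) {κ : Fin K → Γ → ℕ} (hκ : ∀ l, LogFun (κ l)) (σ : Circuit K)
    (i : Fin K) :
    LogPosPred fun g => σ.Holds (D g) (fun l => p l g) (fun l => κ l g) i := by
  induction i using WellFoundedLT.induction with
  | _ i ih =>
    simp only [Circuit.Holds.eq_1 _ _ _ _ i]
    exact gateHolds hD (hp i) (hκ i) (fun l => ih _ l.is_lt) (σ i)

end LogPosPred

section

variable {Γ : Type} [Ctx LearnSym Γ] {m i a b e j p B : Γ → ℕ}

theorem logPred_endAt (he : LogFun e) : LogPred fun g => EndAt (inp g) (e g) :=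
  (LogPred.le .length he).or ((LogPred.getElem?_eq_some _ he).or (.getElem?_eq_some _ he))

theorem logPred_letterAt (hm : LogFun m) (hi : LogFun i) :
    LogPred fun g => LetterAt (inp g) (m g) (i g) :=
  (LogPred.getElem?_eq_some _ hi).and <| .forall_lt hm <|
    (LogPred.getElem?_eq_some _ (hi.fst.succ.add .snd)).or
      (.getElem?_eq_some _ (hi.fst.succ.add .snd))

theorem logPred_lettersAt (hm : LogFun m) (hi : LogFun i) (ha : LogFun a) :
    LogPred fun g => LettersAt (inp g) (m g) (i g) (a g) :=
  .forall_lt ha (logPred_letterAt hm.fst (hi.fst.add (LogFun.snd.mul hm.fst.succ)))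

theorem logPred_wordAt (hm : LogFun m) (hi : LogFun i) (ha : LogFun a) (hb : LogFun b) :
    LogPred fun g => WordAt (inp g) (m g) (i g) (a g) (b g) := by
  have hloop := hi.succ.add (ha.mul hm.succ)
  exact (logPred_lettersAt hm hi.succ ha).and <| (LogPred.getElem?_eq_some _ hloop).and <|
    (logPred_lettersAt hm hloop.succ hb).and (logPred_endAt (hloop.succ.add (hb.mul hm.succ)))

theorem logPred_bitAt (hm : LogFun m) (hi : LogFun i) (ha : LogFun a) (hb : LogFun b)
    (hj : LogFun j) (hp : LogFun p) :
    LogPred fun g => BitAt (inp g) (m g) (i g) (a g) (b g) (j g) (p g) := by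
  have hloop := hi.succ.add (ha.mul hm.succ)
  refine ((LogPred.lt hj ha).and (.getElem?_eq_some _ ?_)).or
    (.exists_lt hj.succ (.exists_lt hb.fst (LogPred.and ?_ (.getElem?_eq_some _ ?_))))
  · exact (hi.succ.add (hj.mul hm.succ)).succ.add hp
  · exact .eq hj.fst.fst ((ha.fst.fst.add (LogFun.snd.fst.mul hb.fst.fst)).add .snd)
  · exact (hloop.succ.fst.fst.add (LogFun.snd.mul hm.succ.fst.fst)).succ.add hp.fst.fst

theorem logPosPred_bitAt (hm : LogFun m) (hi : LogFun i) (ha : LogFun a) (hb : LogFun b)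
    (hp : LogFun p) :
    LogPosPred fun g j => BitAt (inp g) (m g) (i g) (a g) (b g) j (p g) := by
  intro Γ' _ π hπ j hj
  refine (logPred_bitAt (hπ.logFun hm) (hπ.logFun hi) (hπ.logFun ha) (hπ.logFun hb) hj
    (hπ.logFun hp)).congr fun g => ?_
  simp only [hπ.inp_eq]

theorem logPred_header (hm : LogFun m) (hB : LogFun B) :
    LogPred fun g => Header (inp g) (m g) (B g) := by
  have hpairwise : LogPred fun g : Γ => ∀ t < (inp g).length, ∀ s < t,
      ¬ ((inp g)[s]? = some .neg ∧ (inp g)[t]? = some .pos) :=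
    .forall_lt .length (.forall_lt .snd
      ((LogPred.getElem?_eq_some _ .snd).and (.getElem?_eq_some _ LogFun.snd.fst)).not)
  have hunary : LogPred fun g : Γ => (∀ t < m g, (inp g)[t]? = some .prop) ∧
      ∀ t < B g, (inp g)[m g + t]? = some .tick :=
    (LogPred.forall_lt hm (.getElem?_eq_some _ .snd)).and
      (.forall_lt hB (.getElem?_eq_some _ (hm.fst.add .snd)))
  refine (hunary.and hpairwise).congr fun g => and_congr ?_ ?_
  · rw [← List.drop_zero (l := inp g), append_isPrefix_drop_iff, replicate_isPrefix_drop_iff,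
      replicate_isPrefix_drop_iff]
    simp
  · rw [List.pairwise_iff_getElem]
    constructor
    · intro h s t hs ht hst hneg hpos
      exact h t ht s hst ⟨List.getElem?_eq_some_iff.2 ⟨hs, hneg⟩,
        List.getElem?_eq_some_iff.2 ⟨ht, hpos⟩⟩
    · intro h t ht s hst ⟨hneg, hpos⟩
      exact h s t (hst.trans ht) ht hst (List.getElem?_eq_some_iff.1 hneg).2
        (List.getElem?_eq_some_iff.1 hpos).2

end

theorem Header.add_le_length {x : List LearnSym} {m B : ℕ} (h : Header x m B) :
    m + B ≤ x.length := by
  simpa using h.1.length_le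

theorem WordAt.add_lt_length {x : List LearnSym} {m i a b : ℕ} (h : WordAt x m i a b) (hb : 0 < b) :
    a + b < x.length := by
  obtain ⟨-, -, hper, -⟩ := h
  have hlast := (List.getElem?_eq_some_iff.1 (hper (b - 1) (Nat.sub_lt hb one_pos)).1).1
  have ha := Nat.le_mul_of_pos_right a (Nat.add_one_pos m)
  have hb' := Nat.le_mul_of_pos_right (b - 1) (Nat.add_one_pos m)
  omega

namespace Circuit

variable {K : ℕ} {Ut : Set UnOp} {σ : Circuit K} {out : Fin K}

/-- From position `e` on, `x` is a sequence of encodings of words over `m` propositions, of which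
the positive ones are exactly those that satisfy the formula computed at gate `out`. -/
def Separates (σ : Circuit K) (out : Fin K) (θ κ : Fin K → ℕ) (x : List LearnSym) (m e : ℕ) :
    Prop :=
  EndAt x e ∧ ∀ s < x.length, e ≤ s → ∀ k, IsMark k → x[s]? = some k → ∃ a b, 0 < b ∧
    WordAt x m s a b ∧ (σ.Holds (a + b) (fun l t => BitAt x m s a b t (θ l)) κ out 0 ↔ k = .pos)

theorem parsed_iff_separates {x : List LearnSym} {m e : ℕ} {θ : Fin K → Fin m} {κ : Fin K → ℕ} :
    Parsed (fun k w => LTL.Sat w.toWord (σ.inst θ κ out) ↔ k = .pos) x e ↔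
      σ.Separates out (fun l => θ l) κ x m e := by
  have hholds : ∀ s a b (hb : 0 < b),
      LTL.Sat (wordAt x m s a b hb).toWord (σ.inst θ κ out) ↔
        σ.Holds (a + b) (fun l t => BitAt x m s a b t (θ l)) κ out 0 := by
    intro s a b hb
    have := σ.holds_iff_sat_inst (wordAt x m s a b hb) θ κ out 0
    simp only [mem_toWord_wordAt] at this
    simpa [wordAt, lettersAt, LTL.suffix_zero] using this.symm
  refine and_congr_right fun _ => ?_
  simp only [exists_occurs_iff, hholds]
  constructor
  · intro h s _ hes k hk hsk
    obtain ⟨-, a, b, hb, hword, hsat⟩ := h s hes k hk hsk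
    exact ⟨a, b, hb, hword, hsat⟩
  · intro h s hes k hk hsk
    obtain ⟨a, b, hb, hword, hsat⟩ := h s (List.getElem?_eq_some_iff.1 hsk).1 hes k hk hsk
    exact ⟨hsk, a, b, hb, hword, hsat⟩

theorem exists_encode_eq_iff_separates {x : List LearnSym} {m B : ℕ} {θ : Fin K → Fin m}
    {κ : Fin K → ℕ} :
    (∃ P N, LearnInput.encode ⟨m, P, N, B⟩ = x ∧
      (∀ w ∈ P, LTL.Sat w.toWord (σ.inst θ κ out)) ∧
        ∀ w ∈ N, ¬ LTL.Sat w.toWord (σ.inst θ κ out)) ↔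
      Header x m B ∧ σ.Separates out (fun l => θ l) κ x m (m + B) := by
  rw [← parsed_iff_separates, ← exists_encode_eq_iff]
  simp only [iff_true, reduceCtorEq, iff_false]

/-- On the input `x` with `m` propositions and bound `B`, the formula computed at gate `out` is a
solution of the learning problem. -/
def Solves (Ut : Set UnOp) (σ : Circuit K) (out : Fin K) (x : List LearnSym) (m B : ℕ)
    (θ κ : Fin K → ℕ) : Prop :=
  (Header x m B ∧ (∀ l, θ l < m)) ∧ ((∀ l, κ l ≠ 0 → .X ∈ Ut) ∧ σ.size κ ≤ B) ∧
    σ.Separates out θ κ x m (m + B)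

namespace Solves

variable {x : List LearnSym} {m B : ℕ} {θ κ : Fin K → ℕ}

theorem numProp_le_length (h : σ.Solves Ut out x m B θ κ) : m ≤ x.length :=
  (Nat.le_add_right _ _).trans h.1.1.add_le_length

theorem bound_le_length (h : σ.Solves Ut out x m B θ κ) : B ≤ x.length :=
  (Nat.le_add_left _ _).trans h.1.1.add_le_length

theorem param_le_length (h : σ.Solves Ut out x m B θ κ) (l : Fin K) : θ l ≤ x.length :=
  (h.1.2 l).le.trans h.numProp_le_length

theorem count_le_length (h : σ.Solves Ut out x m B θ κ) (l : Fin K) : κ l ≤ x.length :=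
  calc κ l ≤ (σ l).weight + κ l := Nat.le_add_left _ _
    _ ≤ σ.size κ := Finset.single_le_sum (f := fun l => (σ l).weight + κ l)
      (fun _ _ => Nat.zero_le _) (Finset.mem_univ l)
    _ ≤ x.length := h.2.1.2.trans h.bound_le_length

end Solves

section

variable {Γ : Type} [Ctx LearnSym Γ] {m B e : Γ → ℕ} {θ κ : Fin K → Γ → ℕ}

theorem logPred_separates (hθ : ∀ l, LogFun (θ l)) (hκ : ∀ l, LogFun (κ l)) (hm : LogFun m)
    (he : LogFun e) :
    LogPred fun g => σ.Separates out (fun l => θ l g) (fun l => κ l g) (inp g) (m g) (e g) := by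
  refine (logPred_endAt he).and (.forall_lt .length <| (LogPred.le he.fst .snd).imp <|
    .forall_finite fun k => (LogPred.const (IsMark k)).imp <|
      (LogPred.getElem?_eq_some k .snd).imp ?_)
  refine .exists_le (.exists_le ?_ fun g b h => ?_) fun g a ⟨b, h⟩ => ?_
  · have hs : LogFun fun g : ((Γ × ℕ) × ℕ) × ℕ => g.1.1.2 := LogFun.snd.fst.fst
    have ha : LogFun fun g : ((Γ × ℕ) × ℕ) × ℕ => g.1.2 := LogFun.snd.fst
    have hb : LogFun fun g : ((Γ × ℕ) × ℕ) × ℕ => g.2 := .snd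
    have hm := hm.fst.fst.fst
    refine (LogPred.lt .zero hb).and ((logPred_wordAt hm hs ha hb).and
      (LogPred.iff ?_ (.const _)))
    exact LogPosPred.circuitHolds (ha.add hb)
      (fun l => logPosPred_bitAt hm hs ha hb (hθ l).fst.fst.fst) (fun l => (hκ l).fst.fst.fst)
      σ out _ _ .refl _ .zero
  · exact (Nat.le_add_left _ _).trans (h.2.1.add_lt_length h.1).le
  · exact (Nat.le_add_right _ _).trans (h.2.1.add_lt_length h.1).le

theorem logPred_size_le (hκ : ∀ l, LogFun (κ l)) (hB : LogFun B) :
    LogPred fun g => σ.size (fun l => κ l g) ≤ B g :=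
  .le (.sum _ fun l _ => (LogFun.const _).add (hκ l)) hB

theorem logPred_solves (hθ : ∀ l, LogFun (θ l)) (hκ : ∀ l, LogFun (κ l)) (hm : LogFun m)
    (hB : LogFun B) :
    LogPred fun g => σ.Solves Ut out (inp g) (m g) (B g) (fun l => θ l g) fun l => κ l g :=
  ((logPred_header hm hB).and (.forall_finite fun l => .lt (hθ l) hm)).and <|
    ((LogPred.forall_finite fun l => (LogPred.eq (hκ l) .zero).not.imp (.const _)).and
      (logPred_size_le hκ hB)).and (logPred_separates hθ hκ hm (hm.add hB))

theorem logPred_exists_solves (σ : Circuit K) (out : Fin K) :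
    LogPred fun x : List LearnSym => ∃ m B θ κ, σ.Solves Ut out x m B θ κ := by
  refine .exists_le (.exists_le (LogVecPred.exists (fun Γ _ π hπ θ hθ => ?_)
    fun _ _ ⟨_, h⟩ => h.param_le_length) fun _ _ ⟨_, _, h⟩ => h.bound_le_length)
    fun _ _ ⟨_, _, _, h⟩ => h.numProp_le_length
  refine LogVecPred.exists (fun Γ' _ π' hπ' κ hκ => ?_) fun g κ h => ?_
  · have hforgets := hπ.comp hπ'
    refine (logPred_solves (Ut := Ut) (σ := σ) (out := out) (fun l => hπ'.logFun (hθ l)) hκ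
      (hforgets.logFun LogFun.snd.fst) (hforgets.logFun .snd)).congr fun g => ?_
    rw [← hforgets.inp_eq g]
    rfl
  · exact (hπ.inp_eq g).symm ▸ h.count_le_length

end

end Circuit

theorem LearnInput.isPositive_iff {Ut : Set UnOp} {Bl : Set BinLogOp} {n m B : ℕ}
    {P N : List (UPWord (Fin m))} :
    (LearnInput.mk m P N B).IsPositive Ut ∅ Bl n ↔
      ∃ K ≤ 2 * (2 * n + 1), ∃ (σ : Circuit K) (out : Fin K), σ.UsesOnly Ut Bl ∧ σ.numBin ≤ n ∧
        ∃ (θ : Fin K → Fin m) (κ : Fin K → ℕ), (∀ l, κ l ≠ 0 → .X ∈ Ut) ∧ σ.size κ ≤ B ∧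
          (∀ w ∈ P, LTL.Sat w.toWord (σ.inst θ κ out)) ∧
            ∀ w ∈ N, ¬ LTL.Sat w.toWord (σ.inst θ κ out) := by
  rw [← Circuit.exists_formula_iff (P := fun φ =>
    (∀ w ∈ P, LTL.Sat w.toWord φ) ∧ ∀ w ∈ N, ¬ LTL.Sat w.toWord φ)]
  · simp only [IsPositive, Nat.cast_le]
  · intro φ ψ h
    simp only [h _, imp_self]

theorem mem_LTLLearn_iff {Ut : Set UnOp} {Bl : Set BinLogOp} {n : ℕ} {x : List LearnSym} :
    x ∈ LTLLearn Ut ∅ Bl (n : ℕ∞) ↔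
      ∃ K ∈ Set.Iic (2 * (2 * n + 1)), ∃ (σ : Circuit K) (out : Fin K),
        (σ.UsesOnly Ut Bl ∧ σ.numBin ≤ n) ∧ ∃ m B θ κ, σ.Solves Ut out x m B θ κ := by
  constructor
  · rintro ⟨⟨m, P, N, B⟩, hx, hpos⟩
    obtain ⟨K, hK, σ, out, huses, hbin, θ, κ, hX, hsize, hsat⟩ := LearnInput.isPositive_iff.1 hpos
    obtain ⟨hheader, hsep⟩ := Circuit.exists_encode_eq_iff_separates.1 ⟨P, N, hx, hsat⟩
    exact ⟨K, hK, σ, out, ⟨huses, hbin⟩, m, B, fun l => θ l, κ,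
      ⟨hheader, fun l => (θ l).is_lt⟩, ⟨hX, hsize⟩, hsep⟩
  · rintro ⟨K, hK, σ, out, ⟨huses, hbin⟩, m, B, θ, κ, ⟨hheader, hθ⟩, ⟨hX, hsize⟩, hsep⟩
    obtain ⟨P, N, hx, hsat⟩ := Circuit.exists_encode_eq_iff_separates
      (θ := fun l => ⟨θ l, hθ l⟩) |>.2 ⟨hheader, hsep⟩
    exact ⟨⟨m, P, N, B⟩, hx, LearnInput.isPositive_iff.2
      ⟨K, hK, σ, out, huses, hbin, _, κ, hX, hsize, hsat⟩⟩

end Learning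

theorem mainTheorem4 (Ut : Set UnOp) (Bl : Set BinLogOp) (n : ℕ) :
    InLogspace (LTLLearn Ut ∅ Bl (n : ℕ∞)) := by
  refine LogPred.inLogspace (LogPred.congr ?_ fun x => mem_LTLLearn_iff.symm)
  exact .exists_mem (Set.finite_Iic _) fun K _ => .exists_finite fun σ => .exists_finite fun out =>
    (LogPred.const _).and (Circuit.logPred_exists_solves σ out)
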